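/- **Theorem 4.2.** Let $n\ge r$ be natural numbers and let $A_1,\dots,A_m\in\mathbb{C}^{n\times n}$ be Hermitian positive semidefinite. Write $\langle X,Y\rangle_{\mathbb R}=\Re\,\mathrm{tr}(X^*Y)$, $\|X\|_2=\langle X,X\rangle_{\mathbb R}^{1/2}$, and for $x\in\mathbb{C}^{n\times r}$ put $\theta(x)=(xx^*)^{1/2}$ and $\alpha(x)=\big(\langle xx^*,A_j\rangle_{\mathbb R}^{1/2}\big)_{j=1}^m\in\mathbb{R}^m$. Write $[x]=[y]$ if $x=yU$ for some $U\in U(r)$, and $D(x,y)=\min_{U\in U(r)}\|x-yU\|_2$. Let $$A_0=\inf_{[x]\ne[y]}\frac{\|\alpha(x)-\alpha(y)\|_2^2}{\|\theta(x)-\theta(y)\|_2^2}.$$ For $z\in\mathbb{C}^{n\times r}$ of rank $k$ and $\rho(x,y)=\|\theta(x)-\theta(y)\|_2$, let $$A_1(z)=\lim_{R\to0^+}\inf_{\substack{\rho(x,z)\le R,\ \mathrm{rank}(x)\le k\\ [x]\ne[z]}}\frac{\|\alpha(x)-\alpha(z)\|_2^2}{\rho(x,z)^2},\qquad A_2(z)=\lim_{R\to0^+}\inf_{\substack{\rho(x,z)\le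 R,\ \rho(y,z)\le R\\ \mathrm{rank}(x)\le k,\ \mathrm{rank}(y)\le k,\ [x]\ne[y]}}\frac{\|\alpha(x)-\alpha(y)\|_2^2}{\rho(x,y)^2},$$ and let $\hat A_1(z),\hat A_2(z)$ be defined in the same way with $\rho=D$. For $z$ of rank $k>0$ let $\hat z\in\mathbb{C}^{n\times k}$ be of rank $k$ with $z=[\hat z\,|\,0]\,U$ for some $U\in U(r)$. For $X\in\mathbb{C}^{n\times n}$ let $j(X)=\begin{bmatrix}\Re X&-\Im X\\ \Im X&\Re X\end{bmatrix}$, let $F_j=\mathbb{I}_{k\times k}\otimes j(A_j)\in\mathbb{R}^{2nk\times 2nk}$, let $\mu(\hat z)\in\mathbb{R}^{2nk}$ be the vector obtained by stacking the columns of $\begin{bmatrix}\Re\hat z\\ \Im\hat z\end{bmatrix}$, let $I_0(z)=\{j:\alpha_j(z)=0\}$ and $I(z)=\{1,\dots,m\}\setminus I_0(z)$, and put $$\hat T_z=\sum_{j\in I(z)}\frac{F_j\,\mu(\hat z)\mu(\hat z)^T F_j}{\mu(\hat z)^TF_j\,\mu(\hat z)},\qquad \hat R_z=\sum_{j\in I_0(z)}F_j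 .$$ Let $\lambda_i$ denote the $i$-th largest eigenvalue of a real symmetric matrix, counted with multiplicity. Then: (i) If $r>1$, then $\inf_{z\in\mathbb{C}^{n\times r}\setminus\{0\}}A_i(z)=0$ for $i=1,2$, and $A_0=0$. (ii) For every $z\in\mathbb{C}^{n\times r}$ of rank $k>0$ and every such $\hat z$, $$\hat A_1(z)=\lambda_{2nk-k^2}(\hat T_z+\hat R_z),\qquad \hat A_2(z)=\lambda_{2nk-k^2}(\hat T_z).$$ (iii) For every $z\in\mathbb{C}^{n\times r}$ of rank $k>0$ and $i=1,2$, $$A_i(z)\le\hat A_i(z)\le 2A_i(z).$$ -/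

import Mathlib

open scoped Matrix ENNReal Topology MatrixOrder ComplexOrder Kronecker

noncomputable section

namespace PhaseRetrieval

/-! ### The space of `n × r` matrices, the unitary action and the two distances -/

/-- The real inner product `⟨X, Y⟩_ℝ = Re tr(X* Y)` on complex matrices. -/
def rinner {p q : ℕ} (X Y : Matrix (Fin p) (Fin q) ℂ) : ℝ := (Xᴴ * Y).trace.re

section
attribute [local instance] Matrix.frobeniusNormedAddCommGroup

/-- The Schatten 2-norm `‖X‖₂`, that is, the Frobenius norm. -/
def hsNorm {p q : ℕ} (X : Matrix (Fin p) (Fin q) ℂ) : ℝ := ‖X‖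

end

/-- `x ∼ y` iff `x = y U` for some `U ∈ U(r)`; thus `[x] ≠ [y]` is `¬ UEquiv x y`. -/
def UEquiv {n r : ℕ} (x y : Matrix (Fin n) (Fin r) ℂ) : Prop :=
  ∃ U : Matrix.unitaryGroup (Fin r) ℂ, x = y * (U : Matrix (Fin r) (Fin r) ℂ)

/-- The Bures-Wasserstein distance `D(x, y) = min_{U ∈ U(r)} ‖x - y U‖₂`
(the infimum is a minimum because `U(r)` is compact). -/
def distD {n r : ℕ} (x y : Matrix (Fin n) (Fin r) ℂ) : ℝ :=
  ⨅ U : Matrix.unitaryGroup (Fin r) ℂ, hsNorm (x - y * (U : Matrix (Fin r) (Fin r) ℂ))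

/-- `θ(x) = (x x*)^{1/2}`, the positive semidefinite square root. -/
def theta {n r : ℕ} (x : Matrix (Fin n) (Fin r) ℂ) : Matrix (Fin n) (Fin n) ℂ :=
  CFC.sqrt (x * xᴴ)

/-- The distance `‖θ(x) - θ(y)‖₂`. -/
def distTheta {n r : ℕ} (x y : Matrix (Fin n) (Fin r) ℂ) : ℝ :=
  hsNorm (theta x - theta y)

/-! ### The analysis maps -/

/-- `β_j(x) = ⟨x x*, A_j⟩_ℝ`. -/
def beta {n r m : ℕ} (A : Fin m → Matrix (Fin n) (Fin n) ℂ) (x : Matrix (Fin n) (Fin r) ℂ) :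
    EuclideanSpace ℝ (Fin m) :=
  WithLp.toLp 2 fun j => rinner (x * xᴴ) (A j)

/-- `α_j(x) = ⟨x x*, A_j⟩_ℝ^{1/2}`. -/
def alpha {n r m : ℕ} (A : Fin m → Matrix (Fin n) (Fin n) ℂ) (x : Matrix (Fin n) (Fin r) ℂ) :
    EuclideanSpace ℝ (Fin m) :=
  WithLp.toLp 2 fun j => √(beta A x j)

/-! ### Global and local lower Lipschitz bounds (all squared), with values in `[0, ∞]` -/

/-- The squared difference quotient of `α` with respect to a distance `ρ`. -/
def quot {n r m : ℕ} (A : Fin m → Matrix (Fin n) (Fin n) ℂ)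
    (ρ : Matrix (Fin n) (Fin r) ℂ → Matrix (Fin n) (Fin r) ℂ → ℝ)
    (x y : Matrix (Fin n) (Fin r) ℂ) : ℝ≥0∞ :=
  ENNReal.ofReal (‖alpha A x - alpha A y‖ ^ 2 / ρ x y ^ 2)

/-- The infimum of the quotients between `z` and points `x`, `[x] ≠ [z]`, of the closed `ρ`-ball
of radius `R` about `z`, whose rank does not exceed that of `z`. -/
def ballInf₁ {n r m : ℕ} (A : Fin m → Matrix (Fin n) (Fin n) ℂ)
    (ρ : Matrix (Fin n) (Fin r) ℂ → Matrix (Fin n) (Fin r) ℂ → ℝ)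
    (z : Matrix (Fin n) (Fin r) ℂ) (R : ℝ) : ℝ≥0∞ :=
  ⨅ (x : Matrix (Fin n) (Fin r) ℂ) (_ : ρ x z ≤ R) (_ : x.rank ≤ z.rank) (_ : ¬ UEquiv x z),
    quot A ρ x z

/-- The infimum of the quotients between points `x, y`, `[x] ≠ [y]`, of the closed `ρ`-ball of
radius `R` about `z`, whose ranks do not exceed that of `z`. -/
def ballInf₂ {n r m : ℕ} (A : Fin m → Matrix (Fin n) (Fin n) ℂ)
    (ρ : Matrix (Fin n) (Fin r) ℂ → Matrix (Fin n) (Fin r) ℂ → ℝ)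
    (z : Matrix (Fin n) (Fin r) ℂ) (R : ℝ) : ℝ≥0∞ :=
  ⨅ (x : Matrix (Fin n) (Fin r) ℂ) (y : Matrix (Fin n) (Fin r) ℂ)
    (_ : ρ x z ≤ R) (_ : ρ y z ≤ R) (_ : x.rank ≤ z.rank) (_ : y.rank ≤ z.rank)
    (_ : ¬ UEquiv x y), quot A ρ x y

/-- `lim_{R → 0+} f(R)` for `f` antitone in `R`, written as a supremum; that it is the limit for
the functions used here is `tendsto_ballInf₁` and `tendsto_ballInf₂`. -/
def limZero (f : ℝ → ℝ≥0∞) : ℝ≥0∞ := ⨆ (R : ℝ) (_ : 0 < R), f R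

lemma tendsto_limZero {f : ℝ → ℝ≥0∞} (hf : Antitone f) :
    Filter.Tendsto f (𝓝[>] 0) (𝓝 (limZero f)) := by
  have h := hf.tendsto_nhdsGT 0
  rwa [sSup_image] at h

lemma ballInf₁_antitone {n r m : ℕ} (A : Fin m → Matrix (Fin n) (Fin n) ℂ)
    (ρ : Matrix (Fin n) (Fin r) ℂ → Matrix (Fin n) (Fin r) ℂ → ℝ)
    (z : Matrix (Fin n) (Fin r) ℂ) : Antitone (ballInf₁ A ρ z) := fun _ _ hRS =>
  iInf_mono fun _ => iInf_mono' fun h => ⟨h.trans hRS, le_rfl⟩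

lemma ballInf₂_antitone {n r m : ℕ} (A : Fin m → Matrix (Fin n) (Fin n) ℂ)
    (ρ : Matrix (Fin n) (Fin r) ℂ → Matrix (Fin n) (Fin r) ℂ → ℝ)
    (z : Matrix (Fin n) (Fin r) ℂ) : Antitone (ballInf₂ A ρ z) := fun _ _ hRS =>
  iInf_mono fun _ => iInf_mono fun _ => iInf_mono' fun h => ⟨h.trans hRS,
    iInf_mono' fun h' => ⟨h'.trans hRS, le_rfl⟩⟩

lemma tendsto_ballInf₁ {n r m : ℕ} (A : Fin m → Matrix (Fin n) (Fin n) ℂ)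
    (ρ : Matrix (Fin n) (Fin r) ℂ → Matrix (Fin n) (Fin r) ℂ → ℝ)
    (z : Matrix (Fin n) (Fin r) ℂ) :
    Filter.Tendsto (ballInf₁ A ρ z) (𝓝[>] 0) (𝓝 (limZero (ballInf₁ A ρ z))) :=
  tendsto_limZero (ballInf₁_antitone A ρ z)

lemma tendsto_ballInf₂ {n r m : ℕ} (A : Fin m → Matrix (Fin n) (Fin n) ℂ)
    (ρ : Matrix (Fin n) (Fin r) ℂ → Matrix (Fin n) (Fin r) ℂ → ℝ)
    (z : Matrix (Fin n) (Fin r) ℂ) :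
    Filter.Tendsto (ballInf₂ A ρ z) (𝓝[>] 0) (𝓝 (limZero (ballInf₂ A ρ z))) :=
  tendsto_limZero (ballInf₂_antitone A ρ z)

/-- The squared global lower Lipschitz constant `A₀` of `α` on `ℂ^{n×r}`. -/
def A0 {n m : ℕ} (r : ℕ) (A : Fin m → Matrix (Fin n) (Fin n) ℂ) : ℝ≥0∞ :=
  ⨅ (x : Matrix (Fin n) (Fin r) ℂ) (y : Matrix (Fin n) (Fin r) ℂ) (_ : ¬ UEquiv x y),
    quot A distTheta x y

/-- The local lower bound `A₁(z)`. -/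
def A1 {n r m : ℕ} (A : Fin m → Matrix (Fin n) (Fin n) ℂ) (z : Matrix (Fin n) (Fin r) ℂ) :
    ℝ≥0∞ := limZero (ballInf₁ A distTheta z)

/-- The local lower bound `A₂(z)`. -/
def A2 {n r m : ℕ} (A : Fin m → Matrix (Fin n) (Fin n) ℂ) (z : Matrix (Fin n) (Fin r) ℂ) :
    ℝ≥0∞ := limZero (ballInf₂ A distTheta z)

/-- The local lower bound `Â₁(z)` with respect to `D`. -/
def A1hat {n r m : ℕ} (A : Fin m → Matrix (Fin n) (Fin n) ℂ) (z : Matrix (Fin n) (Fin r) ℂ) :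
    ℝ≥0∞ := limZero (ballInf₁ A distD z)

/-- The local lower bound `Â₂(z)` with respect to `D`. -/
def A2hat {n r m : ℕ} (A : Fin m → Matrix (Fin n) (Fin n) ℂ) (z : Matrix (Fin n) (Fin r) ℂ) :
    ℝ≥0∞ := limZero (ballInf₂ A distD z)

/-! ### The reduced factor `ẑ` and the matrices `T̂_z`, `R̂_z` -/

/-- The `n × r` matrix `[w | 0]` (used for `k ≤ r`). -/
def padZero {n k : ℕ} (r : ℕ) (w : Matrix (Fin n) (Fin k) ℂ) : Matrix (Fin n) (Fin r) ℂ :=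
  Matrix.of fun i c => if h : (c : ℕ) < k then w i ⟨c, h⟩ else 0

/-- `w ∈ ℂ_*^{n×k}` is a full-rank factor of `z`: `z = [w | 0] U` for some `U ∈ U(r)`. -/
def IsReduced {n r k : ℕ} (z : Matrix (Fin n) (Fin r) ℂ) (w : Matrix (Fin n) (Fin k) ℂ) : Prop :=
  w.rank = k ∧ ∃ U : Matrix.unitaryGroup (Fin r) ℂ,
    z = padZero r w * (U : Matrix (Fin r) (Fin r) ℂ)

/-- A full-rank factor exists for every `z`. -/
lemma exists_isReduced {n r k : ℕ} (z : Matrix (Fin n) (Fin r) ℂ) (hk : z.rank = k) :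
    ∃ w : Matrix (Fin n) (Fin k) ℂ, IsReduced z w := by
  classical
  have hkr : k ≤ r := hk ▸ (z.rank_le_width)
  let L := Matrix.toEuclideanLin z
  have hL : Module.finrank ℂ (LinearMap.range L) = k := by
    rw [← hk, Matrix.rank_eq_finrank_range_toLin z (EuclideanSpace.basisFun (Fin n) ℂ).toBasis
      (EuclideanSpace.basisFun (Fin r) ℂ).toBasis]
    rfl
  have hker : Module.finrank ℂ (LinearMap.ker L) = r - k := by
    have := L.finrank_range_add_finrank_ker
    rw [hL, finrank_euclideanSpace_fin] at this
    omega
  let b := (stdOrthonormalBasis ℂ (LinearMap.ker L)).reindex (finCongr hker)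
  let s : Set (Fin r) := {c | k ≤ c}
  let v : Fin r → EuclideanSpace ℂ (Fin r) := fun c =>
    if h : k ≤ (c : ℕ) then (b ⟨c - k, by omega⟩ : EuclideanSpace ℂ (Fin r)) else 0
  have hv : Orthonormal ℂ (s.domRestrict v) := by
    have h1 : Orthonormal ℂ fun i => (b i : EuclideanSpace ℂ (Fin r)) :=
      b.orthonormal.comp_linearIsometry (LinearMap.ker L).subtypeₗᵢ
    let e : s → Fin (r - k) := fun c => ⟨c.1 - k, by
      have h1 : k ≤ (c.1 : ℕ) := c.2
      have h2 := c.1.2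
      omega⟩
    have he : Function.Injective e := by
      rintro ⟨c, hc⟩ ⟨d, hd⟩ h
      have hc' : k ≤ (c : ℕ) := hc
      have hd' : k ≤ (d : ℕ) := hd
      have h' : (c : ℕ) - k = d - k := congrArg Fin.val h
      exact Subtype.ext (Fin.ext (by show (c : ℕ) = d; omega))
    have h2 := h1.comp e he
    convert h2 using 1
    funext c
    have hc : k ≤ (c.1 : ℕ) := c.2
    show v c.1 = _
    simp only [v, hc, dite_true, Function.comp_apply, e]
  obtain ⟨B, hB⟩ := hv.exists_orthonormalBasis_extension_of_card_eq (by simp)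
  let V : Matrix.unitaryGroup (Fin r) ℂ :=
    ⟨(EuclideanSpace.basisFun (Fin r) ℂ).toBasis.toMatrix B,
      (EuclideanSpace.basisFun (Fin r) ℂ).toMatrix_orthonormalBasis_mem_unitary B⟩
  let w : Matrix (Fin n) (Fin k) ℂ :=
    Matrix.of fun i c => (z * (V : Matrix (Fin r) (Fin r) ℂ)) i (Fin.castLE hkr c)
  have hpad : z * (V : Matrix (Fin r) (Fin r) ℂ) = padZero r w := by
    ext i c
    by_cases h : (c : ℕ) < k
    · simp [padZero, h, w]
    · have hc : k ≤ (c : ℕ) := not_lt.mp h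
      have h0 : L (B c) = 0 := by
        rw [hB c hc]
        simp only [v, hc, dite_true]
        exact (b _).2
      have h1 := congrFun (congrArg WithLp.ofLp h0) i
      simp only [padZero, h, Matrix.of_apply, dite_false]
      exact h1
  have hz : z = padZero r w * ((V⁻¹ : Matrix.unitaryGroup (Fin r) ℂ) : Matrix (Fin r) (Fin r) ℂ) := by
    rw [← hpad, Matrix.mul_assoc, ← Submonoid.coe_mul, mul_inv_cancel]
    simp
  refine ⟨w, le_antisymm w.rank_le_width ?_, V⁻¹, hz⟩
  have hp : padZero r w = w * Matrix.of fun (a : Fin k) (c : Fin r) =>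
      if (c : ℕ) = a then (1 : ℂ) else 0 := by
    ext i c
    by_cases h : (c : ℕ) < k
    · simp only [padZero, h, Matrix.of_apply, dite_true, Matrix.mul_apply]
      rw [Finset.sum_eq_single ⟨c, h⟩]
      · simp
      · intro d _ hd
        have : (c : ℕ) ≠ d := fun h' => hd (Fin.ext h'.symm)
        simp [this]
      · simp
    · simp only [padZero, h, Matrix.of_apply, dite_false, Matrix.mul_apply]
      refine (Finset.sum_eq_zero fun d _ => ?_).symm
      have : (c : ℕ) ≠ d := by omega
      simp [this]
  calc k = z.rank := hk.symm
    _ ≤ (padZero r w).rank := by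
        conv_lhs => rw [hz]
        exact Matrix.rank_mul_le_left _ _
    _ ≤ w.rank := by
        rw [hp]
        exact Matrix.rank_mul_le_left _ _

/-- The realification `j(X) = [[Re X, -Im X], [Im X, Re X]]`. -/
def realify {n : ℕ} (X : Matrix (Fin n) (Fin n) ℂ) : Matrix (Fin n ⊕ Fin n) (Fin n ⊕ Fin n) ℝ :=
  Matrix.fromBlocks (X.map Complex.re) (-(X.map Complex.im))
    (X.map Complex.im) (X.map Complex.re)

/-- `μ(w) = vec([Re w; Im w])`; the entry with index `(c, s)` is the entry of the `c`-th column of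
`[Re w; Im w]` in row `s`. -/
def mu {n k : ℕ} (w : Matrix (Fin n) (Fin k) ℂ) : Fin k × (Fin n ⊕ Fin n) → ℝ :=
  fun p => Sum.elim (fun i => (w i p.1).re) (fun i => (w i p.1).im) p.2

/-- `F = I_{k×k} ⊗ j(B)`, a real `2nk × 2nk` matrix. -/
def Fmat {n : ℕ} (k : ℕ) (B : Matrix (Fin n) (Fin n) ℂ) :
    Matrix (Fin k × (Fin n ⊕ Fin n)) (Fin k × (Fin n ⊕ Fin n)) ℝ :=
  (1 : Matrix (Fin k) (Fin k) ℝ) ⊗ₖ realify B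

open Classical in
/-- `I₀(z)`, the set of indices `j` with `α_j(z) = 0`; its complement is `I(z)`. -/
def I0 {n r m : ℕ} (A : Fin m → Matrix (Fin n) (Fin n) ℂ) (z : Matrix (Fin n) (Fin r) ℂ) :
    Finset (Fin m) := Finset.univ.filter fun j => alpha A z j = 0

open Classical in
/-- `T̂_z = ∑_{j ∈ I(z)} (μ(ẑ)ᵀ F_j μ(ẑ))⁻¹ F_j μ(ẑ) μ(ẑ)ᵀ F_j`, with `w` for `ẑ`. -/
def That {n r m k : ℕ} (A : Fin m → Matrix (Fin n) (Fin n) ℂ) (z : Matrix (Fin n) (Fin r) ℂ)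
    (w : Matrix (Fin n) (Fin k) ℂ) :
    Matrix (Fin k × (Fin n ⊕ Fin n)) (Fin k × (Fin n ⊕ Fin n)) ℝ :=
  ∑ j ∈ (I0 A z)ᶜ, (mu w ⬝ᵥ Fmat k (A j) *ᵥ mu w)⁻¹ •
    (Fmat k (A j) * Matrix.vecMulVec (mu w) (mu w) * Fmat k (A j))

/-- `R̂_z = ∑_{j ∈ I₀(z)} F_j`. -/
def Rhat {n r m : ℕ} (k : ℕ) (A : Fin m → Matrix (Fin n) (Fin n) ℂ)
    (z : Matrix (Fin n) (Fin r) ℂ) :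
    Matrix (Fin k × (Fin n ⊕ Fin n)) (Fin k × (Fin n ⊕ Fin n)) ℝ :=
  ∑ j ∈ I0 A z, Fmat k (A j)

/-- `λ_i(M)`: the `i`-th largest eigenvalue, counted with multiplicity from `i = 1`, of a real
symmetric matrix `M`. -/
def lam {ι : Type*} [Fintype ι] [DecidableEq ι] {M : Matrix ι ι ℝ} (hM : M.IsHermitian) (i : ℕ) :
    ℝ :=
  if h : 1 ≤ i ∧ i ≤ Fintype.card ι then hM.eigenvalues₀ ⟨i - 1, by omega⟩ else 0

lemma Fmat_isHermitian {n : ℕ} (k : ℕ) {B : Matrix (Fin n) (Fin n) ℂ} (hB : B.IsHermitian) :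
    (Fmat k B).IsHermitian := by
  have h : (realify B).IsHermitian := by
    ext (i | i) (j | j)
    · simpa [realify] using congrArg Complex.re (hB.apply i j)
    · have := congrArg Complex.im (hB.apply i j)
      simp [realify] at this ⊢
      linarith
    · have := congrArg Complex.im (hB.apply i j)
      simp [realify] at this ⊢
      linarith
    · simpa [realify] using congrArg Complex.re (hB.apply i j)
  unfold Fmat Matrix.IsHermitian
  rw [Matrix.conjTranspose_kronecker, h.eq, Matrix.conjTranspose_one]

lemma That_isHermitian {n r m : ℕ} {A : Fin m → Matrix (Fin n) (Fin n) ℂ}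
    (hA : ∀ j, (A j).PosSemidef) (z : Matrix (Fin n) (Fin r) ℂ) {k : ℕ}
    (w : Matrix (Fin n) (Fin k) ℂ) : (That A z w).IsHermitian := by
  unfold That Matrix.IsHermitian
  rw [Matrix.conjTranspose_sum]
  refine Finset.sum_congr rfl fun j _ => ?_
  rw [Matrix.conjTranspose_smul, Matrix.conjTranspose_mul, Matrix.conjTranspose_mul,
    (Fmat_isHermitian k (hA j).isHermitian).eq, Matrix.mul_assoc,
    Matrix.conjTranspose_vecMulVec, star_trivial, star_trivial]

lemma That_add_Rhat_isHermitian {n r m : ℕ} {A : Fin m → Matrix (Fin n) (Fin n) ℂ}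
    (hA : ∀ j, (A j).PosSemidef) (z : Matrix (Fin n) (Fin r) ℂ) {k : ℕ}
    (w : Matrix (Fin n) (Fin k) ℂ) : (That A z w + Rhat k A z).IsHermitian := by
  refine (That_isHermitian hA z w).add ?_
  unfold Rhat Matrix.IsHermitian
  rw [Matrix.conjTranspose_sum]
  exact Finset.sum_congr rfl fun j _ => (Fmat_isHermitian k (hA j).isHermitian).eq

end PhaseRetrieval

end

/-!
All statements are reduced to the Bures-Wasserstein distance `D` between optimally aligned
representatives. For a square matrix `M`, a unitary `V` maximising `Re tr (M V)` makes `M V`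
positive semidefinite (`exists_mul_posSemidef`), and `D(x, y) = ‖x - y‖` as soon as `x* y` is
positive semidefinite (`distD_eq_hsNorm`). Appending zero columns keeps pairs aligned, so
`D` can be computed with any number of columns (`distD_padZero`).

*Comparison with `A_i`.* One has `D ≤ ρ_θ ≤ √2 D`. With `n` columns, `θ(x)` is itself a
representative of `[x]`, which gives the first inequality (`distD_le_distTheta`); the second is the
Araki-Yamagami inequality, proved with Hermitian dilations (`distTheta_sq_le_hsNorm_sq`). Comparing
balls and quotients then gives `A_i ≤ Â_i ≤ 2 A_i`.

*Vanishing of the global bounds.* On the pencil `[a | s b | 0]` with `a ⟂ b` the measurements depend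
on `s` only through `s²`, while `D` is proportional to the change of `s`. Thus their quotients tend
to zero with `s` (`quot_pencil_le`, `iInf_A1_eq_zero`), if `a` lies outside the kernels of all
nonzero `A_j`.

*The values of `Â_i`.* After reduction to full-rank `n × k` factors, points near `w = ẑ` can be
aligned, so that differences are horizontal: `w* v` is Hermitian, up to small errors. For `j ∈ I(z)`
the function `α_j` is strictly differentiable at `w`, and these terms contribute the quadratic form
of `T̂_z`. For `j ∈ I₀(z)`, `α_j(w + v)² = ⟨v, A_j v⟩`, which contributes `R̂_z` to `Â₁`; it does
not contribute to `Â₂`, because `α_j(w + v) = α_j(w - v)`. By compactness (`exists_ball_le_sum`) the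
local bounds are the minima of these forms over horizontal unit directions. Both forms are
nonnegative and vanish on the `k²`-dimensional orthogonal complement `{w K : K* = -K}` of the
horizontal space, so the minima are eigenvalues number `2nk - k²` (`lam_isLeast_horizontal`).
-/

namespace PhaseRetrieval

/-! ### The real inner product and the Frobenius norm -/

section InnerProduct

variable {p q s : ℕ}

lemma rinner_eq_sum (X Y : Matrix (Fin p) (Fin q) ℂ) :
    rinner X Y = ∑ j, ∑ i, ((X i j).re * (Y i j).re + (X i j).im * (Y i j).im) := by
  simp [rinner, Matrix.trace, Matrix.mul_apply]

lemma rinner_comm (X Y : Matrix (Fin p) (Fin q) ℂ) : rinner X Y = rinner Y X := by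
  simp only [rinner_eq_sum, mul_comm]

lemma rinner_add_left (X Y Z : Matrix (Fin p) (Fin q) ℂ) :
    rinner (X + Y) Z = rinner X Z + rinner Y Z := by
  simp [rinner, Matrix.add_mul]

lemma rinner_sub_left (X Y Z : Matrix (Fin p) (Fin q) ℂ) :
    rinner (X - Y) Z = rinner X Z - rinner Y Z := by
  simp [rinner, Matrix.sub_mul]

lemma rinner_sub_right (X Y Z : Matrix (Fin p) (Fin q) ℂ) :
    rinner X (Y - Z) = rinner X Y - rinner X Z := by
  simp [rinner, Matrix.mul_sub]

lemma rinner_smul_left (c : ℝ) (X Y : Matrix (Fin p) (Fin q) ℂ) :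
    rinner (c • X) Y = c * rinner X Y := by
  simp [rinner]

lemma rinner_smul_right (c : ℝ) (X Y : Matrix (Fin p) (Fin q) ℂ) :
    rinner X (c • Y) = c * rinner X Y := by
  simp [rinner]

lemma rinner_mul_left (B : Matrix (Fin s) (Fin p) ℂ) (X : Matrix (Fin p) (Fin q) ℂ)
    (Y : Matrix (Fin s) (Fin q) ℂ) : rinner (B * X) Y = rinner X (Bᴴ * Y) := by
  simp [rinner, Matrix.mul_assoc]

lemma rinner_self_nonneg (X : Matrix (Fin p) (Fin q) ℂ) : 0 ≤ rinner X X := by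
  rw [rinner_eq_sum]
  exact Finset.sum_nonneg fun j _ => Finset.sum_nonneg fun i _ =>
    add_nonneg (mul_self_nonneg _) (mul_self_nonneg _)

lemma hsNorm_nonneg (X : Matrix (Fin p) (Fin q) ℂ) : 0 ≤ hsNorm X := by
  let := Matrix.frobeniusNormedAddCommGroup (m := Fin p) (n := Fin q) (α := ℂ)
  exact norm_nonneg X

lemma hsNorm_sq (X : Matrix (Fin p) (Fin q) ℂ) : hsNorm X ^ 2 = rinner X X := by
  rw [hsNorm, Matrix.frobenius_norm_def, ← Real.sqrt_eq_rpow, Real.sq_sqrt (by positivity),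
    rinner_eq_sum, Finset.sum_comm]
  refine Finset.sum_congr rfl fun j _ => Finset.sum_congr rfl fun i _ => ?_
  rw [Real.rpow_two, Complex.sq_norm, Complex.normSq_apply]

lemma hsNorm_eq_zero {X : Matrix (Fin p) (Fin q) ℂ} : hsNorm X = 0 ↔ X = 0 := by
  let := Matrix.frobeniusNormedAddCommGroup (m := Fin p) (n := Fin q) (α := ℂ)
  exact norm_eq_zero

lemma hsNorm_sub_comm (X Y : Matrix (Fin p) (Fin q) ℂ) : hsNorm (X - Y) = hsNorm (Y - X) := by
  let := Matrix.frobeniusNormedAddCommGroup (m := Fin p) (n := Fin q) (α := ℂ)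
  exact norm_sub_rev X Y

lemma hsNorm_sub_le (X Y Z : Matrix (Fin p) (Fin q) ℂ) :
    hsNorm (X - Z) ≤ hsNorm (X - Y) + hsNorm (Y - Z) := by
  let := Matrix.frobeniusNormedAddCommGroup (m := Fin p) (n := Fin q) (α := ℂ)
  exact norm_sub_le_norm_sub_add_norm_sub X Y Z

lemma hsNorm_smul (c : ℝ) (X : Matrix (Fin p) (Fin q) ℂ) : hsNorm (c • X) = |c| * hsNorm X := by
  let := Matrix.frobeniusNormedAddCommGroup (m := Fin p) (n := Fin q) (α := ℂ)
  let : NormedSpace ℝ (Matrix (Fin p) (Fin q) ℂ) := Matrix.frobeniusNormedSpace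
  exact norm_smul c X

lemma hsNorm_le_iff {X : Matrix (Fin p) (Fin q) ℂ} {Y : Matrix (Fin s) (Fin q) ℂ} :
    hsNorm X ≤ hsNorm Y ↔ rinner X X ≤ rinner Y Y := by
  rw [← hsNorm_sq, ← hsNorm_sq, sq_le_sq₀ (hsNorm_nonneg _) (hsNorm_nonneg _)]

lemma rinner_mul_unitary (X Y : Matrix (Fin p) (Fin q) ℂ)
    (U : Matrix.unitaryGroup (Fin q) ℂ) :
    rinner (X * (U : Matrix (Fin q) (Fin q) ℂ)) (Y * (U : Matrix (Fin q) (Fin q) ℂ)) =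
      rinner X Y := by
  have hU : (U : Matrix (Fin q) (Fin q) ℂ) * (U : Matrix (Fin q) (Fin q) ℂ)ᴴ = 1 := U.2.2
  rw [rinner, rinner, Matrix.conjTranspose_mul, Matrix.mul_assoc, Matrix.trace_mul_comm,
    ← Matrix.mul_assoc, Matrix.mul_assoc _ _ (U : Matrix (Fin q) (Fin q) ℂ)ᴴ, hU, Matrix.mul_one]

lemma hsNorm_mul_unitary (X : Matrix (Fin p) (Fin q) ℂ) (U : Matrix.unitaryGroup (Fin q) ℂ) :
    hsNorm (X * (U : Matrix (Fin q) (Fin q) ℂ)) = hsNorm X := by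
  rw [← sq_eq_sq₀ (hsNorm_nonneg _) (hsNorm_nonneg _), hsNorm_sq, hsNorm_sq, rinner_mul_unitary]

end InnerProduct

/-! ### Alignment by a unitary factor -/

section Alignment

variable {n k q r : ℕ}

lemma isCompact_unitaryGroup (q : ℕ) :
    IsCompact (Matrix.unitaryGroup (Fin q) ℂ : Set (Matrix (Fin q) (Fin q) ℂ)) := by
  have hK : IsCompact (Set.univ.pi fun _ => Set.univ.pi fun _ => Metric.closedBall 0 1 :
      Set (Fin q → Fin q → ℂ)) :=
    isCompact_univ_pi fun _ => isCompact_univ_pi fun _ => isCompact_closedBall _ _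
  refine hK.of_isClosed_subset ?_ fun U hU => ?_
  · exact isClosed_unitary (R := Matrix (Fin q) (Fin q) ℂ)
  · simp only [Set.mem_pi, Set.mem_univ, true_imp_iff, mem_closedBall_zero_iff]
    exact fun i j => entry_norm_bound_of_unitary hU i j

/-- The phase rotation `1 + (γ - 1) v v* / |v|²` by `γ` along `v` is unitary when `|γ| = 1`. -/
lemma phase_mem_unitaryGroup {v : Fin q → ℂ} (hv : v ≠ 0) {γ : ℂ} (hγ : star γ * γ = 1) :
    1 + ((γ - 1) / (star v ⬝ᵥ v)) • Matrix.vecMulVec v (star v) ∈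
      Matrix.unitaryGroup (Fin q) ℂ := by
  have hs : star v ⬝ᵥ v ≠ 0 := by simpa using hv
  have hsr : star (star v ⬝ᵥ v) = star v ⬝ᵥ v := by
    rw [← Matrix.star_dotProduct_star, star_star]
  rw [Matrix.mem_unitaryGroup_iff']
  simp only [Matrix.star_eq_conjTranspose, Matrix.conjTranspose_add, Matrix.conjTranspose_one,
    Matrix.conjTranspose_smul, Matrix.conjTranspose_vecMulVec, star_star, Matrix.add_mul,
    Matrix.mul_add, Matrix.one_mul, Matrix.mul_one, Matrix.smul_mul, Matrix.mul_smul,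
    Matrix.vecMulVec_mul_vecMulVec, star_div₀, hsr, star_sub, star_one]
  rw [add_assoc, add_eq_left, Matrix.vecMulVec_smul]
  simp only [smul_add, smul_smul, ← add_smul]
  convert zero_smul ℂ _ using 2
  field_simp
  linear_combination hγ

/-- Polar decomposition of a square matrix: the unitary factor maximises `Re tr (M U)`, as the
phase rotations `1 + (γ - 1) v v* / |v|²` show. -/
lemma exists_mul_posSemidef (M : Matrix (Fin q) (Fin q) ℂ) :
    ∃ V : Matrix.unitaryGroup (Fin q) ℂ, (M * (V : Matrix (Fin q) (Fin q) ℂ)).PosSemidef := by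
  have hc : ContinuousOn (fun U : Matrix (Fin q) (Fin q) ℂ => (M * U).trace.re)
      (Matrix.unitaryGroup (Fin q) ℂ : Set (Matrix (Fin q) (Fin q) ℂ)) := by
    refine Continuous.continuousOn ?_
    exact Complex.continuous_re.comp (Continuous.matrix_trace (continuous_const.mul continuous_id))
  obtain ⟨V, hV, hmax⟩ := (isCompact_unitaryGroup q).exists_isMaxOn ⟨1, one_mem _⟩ hc
  refine ⟨⟨V, hV⟩, ?_⟩
  set N := M * V with hN
  have key : ∀ v : Fin q → ℂ, 0 ≤ star v ⬝ᵥ (N *ᵥ v) := by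
    intro v
    by_cases hv : v = 0
    · simp [hv]
    set c := star v ⬝ᵥ (N *ᵥ v) with hcdef
    by_cases hc0 : c = 0
    · rw [hc0]
    have hcn : (‖c‖ : ℂ) ≠ 0 := by simpa using hc0
    -- the phase that rotates `c` onto the positive half-line
    set γ : ℂ := star c / ‖c‖ with hγdef
    have hγ : star γ * γ = 1 := by
      rw [hγdef, star_div₀, star_star, div_mul_div_comm]
      simp only [RCLike.star_def, Complex.conj_ofReal]
      rw [Complex.mul_conj, Complex.normSq_eq_norm_sq]
      push_cast
      field_simp
    have hU := phase_mem_unitaryGroup hv hγ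
    have h := hmax (Submonoid.mul_mem _ hV hU)
    have htr : (M * (V * (1 + ((γ - 1) / (star v ⬝ᵥ v)) • Matrix.vecMulVec v (star v)))).trace =
        N.trace + (γ - 1) / (star v ⬝ᵥ v) * c := by
      rw [← Matrix.mul_assoc, ← hN, Matrix.mul_add, Matrix.mul_one, Matrix.trace_add,
        Matrix.mul_smul, Matrix.trace_smul, Matrix.mul_vecMulVec, Matrix.trace_vecMulVec,
        dotProduct_comm _ (star v), smul_eq_mul]
    simp only [Set.mem_ofPred_eq, htr, Complex.add_re] at h
    have hspos : 0 < star v ⬝ᵥ v := by simpa using hv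
    obtain ⟨s, hs⟩ : ∃ s : ℝ, (s : ℂ) = star v ⬝ᵥ v :=
      ⟨(star v ⬝ᵥ v).re, (Complex.eq_re_of_ofReal_le hspos.le).symm⟩
    rw [← hs] at h hspos
    have hspos' : 0 < s := by exact_mod_cast hspos
    have hγc : γ * c = ‖c‖ := by
      rw [hγdef, div_mul_eq_mul_div, RCLike.star_def, mul_comm, Complex.mul_conj,
        Complex.normSq_eq_norm_sq]
      push_cast
      field_simp
    have h3 : ((γ - 1) / s * c).re = (‖c‖ - c.re) / s := by
      rw [div_mul_eq_mul_div, sub_mul, hγc, one_mul, Complex.div_ofReal_re, Complex.sub_re,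
        Complex.ofReal_re]
    rw [h3] at h
    have h4 : ‖c‖ ≤ c.re := by
      have : (‖c‖ - c.re) / s ≤ 0 := by linarith
      rcases div_nonpos_iff.mp this with h | h <;> linarith [h.1, h.2]
    have h5 := Complex.re_le_norm c
    have h6 : c.re = ‖c‖ := le_antisymm h5 h4
    exact Complex.re_eq_norm.mp h6
  rw [← Matrix.isPositive_toEuclideanLin_iff, LinearMap.isPositive_iff_complex]
  intro x
  have h := key x.ofLp
  have h1 : inner ℂ (Matrix.toEuclideanLin N x) x = star (star x.ofLp ⬝ᵥ (N *ᵥ x.ofLp)) := by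
    rw [EuclideanSpace.inner_eq_star_dotProduct, Matrix.star_dotProduct, star_star, dotProduct_comm]
    rfl
  have h2 : star (star x.ofLp ⬝ᵥ (N *ᵥ x.ofLp)) = star x.ofLp ⬝ᵥ (N *ᵥ x.ofLp) :=
    (IsSelfAdjoint.of_nonneg h).star_eq
  rw [h1, h2]
  exact ⟨(Complex.eq_re_of_ofReal_le h).symm, (Complex.nonneg_iff.mp h).1⟩

lemma exists_conjTranspose_mul_posSemidef (x y : Matrix (Fin n) (Fin r) ℂ) :
    ∃ V : Matrix.unitaryGroup (Fin r) ℂ,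
      (xᴴ * (y * (V : Matrix (Fin r) (Fin r) ℂ))).PosSemidef := by
  obtain ⟨V, hV⟩ := exists_mul_posSemidef (xᴴ * y)
  exact ⟨V, by rwa [← Matrix.mul_assoc]⟩

lemma conjTranspose_mul_posSemidef_symm {x y : Matrix (Fin n) (Fin r) ℂ}
    (h : (xᴴ * y).PosSemidef) : (yᴴ * x).PosSemidef := by
  have := h.isHermitian.eq
  rw [Matrix.conjTranspose_mul, Matrix.conjTranspose_conjTranspose] at this
  rwa [this]

/-! ### The Bures-Wasserstein distance -/

lemma distD_le (x y : Matrix (Fin n) (Fin r) ℂ) (U : Matrix.unitaryGroup (Fin r) ℂ) :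
    distD x y ≤ hsNorm (x - y * (U : Matrix (Fin r) (Fin r) ℂ)) :=
  ciInf_le ⟨0, by rintro _ ⟨V, rfl⟩; exact hsNorm_nonneg _⟩ U

lemma distD_nonneg (x y : Matrix (Fin n) (Fin r) ℂ) : 0 ≤ distD x y :=
  Real.iInf_nonneg fun _ => hsNorm_nonneg _

lemma distD_le_hsNorm (x y : Matrix (Fin n) (Fin r) ℂ) : distD x y ≤ hsNorm (x - y) := by
  simpa using distD_le x y 1

/-- If `x* y` is positive semidefinite, `x` and `y` are optimally aligned: with `x* y = B* B`,
`‖x - y U‖² - ‖x - y‖² = ‖B - B U‖² ≥ 0`. -/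
lemma distD_eq_hsNorm {x y : Matrix (Fin n) (Fin r) ℂ} (h : (xᴴ * y).PosSemidef) :
    distD x y = hsNorm (x - y) := by
  refine le_antisymm (distD_le_hsNorm x y) (le_ciInf fun U => ?_)
  obtain ⟨B, hB⟩ := CStarAlgebra.nonneg_iff_eq_star_mul_self.mp h.nonneg
  rw [hsNorm_le_iff]
  have h1 : ∀ V : Matrix.unitaryGroup (Fin r) ℂ,
      rinner x (y * (V : Matrix (Fin r) (Fin r) ℂ)) =
      rinner B (B * (V : Matrix (Fin r) (Fin r) ℂ)) := by
    intro V
    rw [rinner, rinner, ← Matrix.mul_assoc, hB, Matrix.star_eq_conjTranspose, Matrix.mul_assoc]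
  have h2 := rinner_self_nonneg (B - B * (U : Matrix (Fin r) (Fin r) ℂ))
  have h3 := h1 1
  have h4 := h1 U
  have h5 := rinner_comm x y
  have h6 := rinner_comm x (y * (U : Matrix (Fin r) (Fin r) ℂ))
  have h7 := rinner_comm B (B * (U : Matrix (Fin r) (Fin r) ℂ))
  simp only [OneMemClass.coe_one, Matrix.mul_one] at h3
  simp only [rinner_sub_left, rinner_sub_right, rinner_mul_unitary] at h2 ⊢
  linarith

lemma distD_mul_unitary_right (x y : Matrix (Fin n) (Fin r) ℂ)
    (V : Matrix.unitaryGroup (Fin r) ℂ) :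
    distD x (y * (V : Matrix (Fin r) (Fin r) ℂ)) = distD x y := by
  refine (Equiv.iInf_congr (Equiv.mulLeft V) fun U => ?_)
  rw [Equiv.coe_mulLeft, Submonoid.coe_mul, Matrix.mul_assoc]

lemma distD_mul_unitary_left (x y : Matrix (Fin n) (Fin r) ℂ)
    (V : Matrix.unitaryGroup (Fin r) ℂ) :
    distD (x * (V : Matrix (Fin r) (Fin r) ℂ)) y = distD x y := by
  refine (Equiv.iInf_congr (Equiv.mulRight V⁻¹) fun U => ?_)
  have hV : (V : Matrix (Fin r) (Fin r) ℂ) * ((V⁻¹ : Matrix.unitaryGroup (Fin r) ℂ) :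
      Matrix (Fin r) (Fin r) ℂ) = 1 := by
    rw [← Submonoid.coe_mul, mul_inv_cancel, OneMemClass.coe_one]
  rw [Equiv.coe_mulRight, Submonoid.coe_mul, ← hsNorm_mul_unitary (x * _ - _) V⁻¹, Matrix.sub_mul,
    Matrix.mul_assoc, hV, Matrix.mul_one, Matrix.mul_assoc]

lemma UEquiv.distD_eq_zero {x y : Matrix (Fin n) (Fin r) ℂ} (h : UEquiv x y) :
    distD x y = 0 := by
  obtain ⟨U, rfl⟩ := h
  refine le_antisymm ((distD_le _ _ U).trans ?_) (distD_nonneg _ _)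
  rw [sub_self, hsNorm_eq_zero.mpr rfl]

/-- `[w | 0]` as the product of `w` with the `k × r` matrix `[1 | 0]`. -/
lemma padZero_eq_mul (r : ℕ) (w : Matrix (Fin n) (Fin k) ℂ) :
    padZero r w = w * Matrix.of fun (a : Fin k) (c : Fin r) =>
      if (a : ℕ) = c then (1 : ℂ) else 0 := by
  ext i c
  by_cases h : (c : ℕ) < k
  · simp only [padZero, h, Matrix.of_apply, dite_true, Matrix.mul_apply]
    rw [Finset.sum_eq_single ⟨c, h⟩]
    · simp
    · intro d _ hd
      have : (d : ℕ) ≠ c := fun h' => hd (Fin.ext h')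
      simp [this]
    · simp
  · simp only [padZero, h, Matrix.of_apply, dite_false, Matrix.mul_apply]
    refine (Finset.sum_eq_zero fun d _ => ?_).symm
    have : (d : ℕ) ≠ c := by omega
    simp [this]

lemma incl_mul_conjTranspose (h : k ≤ r) :
    (Matrix.of fun (a : Fin k) (c : Fin r) => if (a : ℕ) = c then (1 : ℂ) else 0) *
      (Matrix.of fun (a : Fin k) (c : Fin r) => if (a : ℕ) = c then (1 : ℂ) else 0)ᴴ = 1 := by
  ext a b
  rw [Matrix.mul_apply, Finset.sum_eq_single (Fin.castLE h a)]
  · by_cases hab : a = b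
    · subst hab; simp
    · have : (b : ℕ) ≠ a := fun h' => hab (Fin.ext h'.symm)
      simp [hab, this]
  · intro c _ hc
    have : (a : ℕ) ≠ c := fun h' => hc (Fin.ext (by simpa using h'.symm))
    simp [this]
  · simp

lemma padZero_mul_conjTranspose (h : k ≤ r) (v w : Matrix (Fin n) (Fin k) ℂ) :
    padZero r v * (padZero r w)ᴴ = v * wᴴ := by
  rw [padZero_eq_mul, padZero_eq_mul, Matrix.conjTranspose_mul, Matrix.mul_assoc,
    ← Matrix.mul_assoc _ _ wᴴ, incl_mul_conjTranspose h, Matrix.one_mul]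

lemma padZero_sub (v w : Matrix (Fin n) (Fin k) ℂ) :
    padZero r v - padZero r w = padZero r (v - w) := by
  simp only [padZero_eq_mul, Matrix.sub_mul]

lemma hsNorm_padZero (h : k ≤ r) (w : Matrix (Fin n) (Fin k) ℂ) :
    hsNorm (padZero r w) = hsNorm w := by
  rw [← sq_eq_sq₀ (hsNorm_nonneg _) (hsNorm_nonneg _), hsNorm_sq, hsNorm_sq, rinner, rinner,
    Matrix.trace_mul_comm, padZero_mul_conjTranspose h, Matrix.trace_mul_comm]

/-- A unitary `V` of size `k` acts on `[w | 0]` through the block matrix `diag(V, 1)`. -/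
lemma exists_unitary_padZero (h : k ≤ r) (V : Matrix.unitaryGroup (Fin k) ℂ) :
    ∃ U : Matrix.unitaryGroup (Fin r) ℂ, ∀ w : Matrix (Fin n) (Fin k) ℂ,
      padZero r (w * (V : Matrix (Fin k) (Fin k) ℂ)) =
        padZero r w * (U : Matrix (Fin r) (Fin r) ℂ) := by
  have hJ := incl_mul_conjTranspose h
  set J : Matrix (Fin k) (Fin r) ℂ :=
    Matrix.of fun (a : Fin k) (c : Fin r) => if (a : ℕ) = c then (1 : ℂ) else 0 with hJdef
  obtain ⟨V, hVU⟩ := V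
  have hV : Vᴴ * V = 1 := hVU.1
  have hJ1 : J * (1 - Jᴴ * J) = 0 := by
    rw [Matrix.mul_sub, ← Matrix.mul_assoc, hJ, Matrix.mul_one, Matrix.one_mul, sub_self]
  have hJ2 : (1 - Jᴴ * J) * Jᴴ = 0 := by
    rw [Matrix.sub_mul, Matrix.mul_assoc, hJ, Matrix.mul_one, Matrix.one_mul, sub_self]
  refine ⟨⟨Jᴴ * V * J + (1 - Jᴴ * J), ?_⟩, fun w => ?_⟩
  · rw [Matrix.mem_unitaryGroup_iff', Matrix.star_eq_conjTranspose]
    have e1 : (Jᴴ * V * J + (1 - Jᴴ * J))ᴴ = Jᴴ * Vᴴ * J +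
        (1 - Jᴴ * J) := by
      simp [Matrix.conjTranspose_mul, Matrix.mul_assoc]
    have e2 : Jᴴ * Vᴴ * J * (Jᴴ * V * J) = Jᴴ * J := by
      calc _ = Jᴴ * (Vᴴ * (J * Jᴴ) * V) * J := by
            simp only [Matrix.mul_assoc]
        _ = _ := by rw [hJ, Matrix.mul_one, hV, Matrix.mul_one]
    rw [e1, Matrix.add_mul, Matrix.mul_add, Matrix.mul_add, e2, Matrix.mul_assoc _ J (1 - _), hJ1,
      ← Matrix.mul_assoc (1 - _), ← Matrix.mul_assoc (1 - _), hJ2, Matrix.mul_sub _ 1,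
      ← Matrix.mul_assoc _ Jᴴ, hJ2]
    simp
  · rw [padZero_eq_mul, padZero_eq_mul, ← hJdef, Matrix.mul_add, Matrix.mul_assoc w J (1 - _), hJ1,
      Matrix.mul_zero, add_zero, Matrix.mul_assoc Jᴴ, ← Matrix.mul_assoc, Matrix.mul_assoc w J, hJ,
      Matrix.mul_one, Matrix.mul_assoc]

/-- Appending zero columns does not change the Bures-Wasserstein distance, since it keeps optimally
aligned pairs optimally aligned. -/
lemma distD_padZero (h : k ≤ r) (v w : Matrix (Fin n) (Fin k) ℂ) :
    distD (padZero r v) (padZero r w) = distD v w := by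
  obtain ⟨V, hV⟩ := exists_conjTranspose_mul_posSemidef v w
  obtain ⟨U, hU⟩ := exists_unitary_padZero (n := n) h V
  have h2 : ((padZero r v)ᴴ * padZero r (w * (V : Matrix (Fin k) (Fin k) ℂ))).PosSemidef := by
    have := hV.conjTranspose_mul_mul_same
      (Matrix.of fun (a : Fin k) (c : Fin r) => if (a : ℕ) = c then (1 : ℂ) else 0)
    rwa [padZero_eq_mul, padZero_eq_mul, Matrix.conjTranspose_mul, Matrix.mul_assoc,
      ← Matrix.mul_assoc vᴴ, ← Matrix.mul_assoc]
  rw [← distD_mul_unitary_right v w V, distD_eq_hsNorm hV, ← distD_mul_unitary_right _ _ U, ← hU,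
    distD_eq_hsNorm h2, padZero_sub, hsNorm_padZero h]

end Alignment

/-! ### Comparison of the two distances -/

section Comparison

variable {n r m : ℕ}

lemma rinner_theta_self (x : Matrix (Fin n) (Fin r) ℂ) :
    rinner (theta x) (theta x) = rinner x x := by
  have h0 : 0 ≤ x * xᴴ := (Matrix.posSemidef_self_mul_conjTranspose x).nonneg
  have h1 : (theta x)ᴴ = theta x :=
    (Matrix.nonneg_iff_posSemidef.mp (CFC.sqrt_nonneg (x * xᴴ))).isHermitian.eq
  rw [rinner, rinner, h1, theta, CFC.sqrt_mul_sqrt_self _ h0, Matrix.trace_mul_comm]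

lemma theta_padZero {k : ℕ} (h : k ≤ r) (w : Matrix (Fin n) (Fin k) ℂ) :
    theta (padZero r w) = theta w := by
  rw [theta, theta, padZero_mul_conjTranspose h]

/-- For square `x`, the polar decomposition reads `θ(x) = x V` with `V` unitary. -/
lemma exists_theta_eq_mul (x : Matrix (Fin n) (Fin n) ℂ) :
    ∃ V : Matrix.unitaryGroup (Fin n) ℂ, theta x = x * (V : Matrix (Fin n) (Fin n) ℂ) := by
  obtain ⟨V, hV⟩ := exists_mul_posSemidef x
  refine ⟨V, CFC.sqrt_unique ?_ hV.nonneg⟩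
  have hVV : (V : Matrix (Fin n) (Fin n) ℂ) * (V : Matrix (Fin n) (Fin n) ℂ)ᴴ = 1 := V.2.2
  have h := hV.isHermitian.eq
  nth_rewrite 2 [← h]
  rw [Matrix.conjTranspose_mul, Matrix.mul_assoc, ← Matrix.mul_assoc _ _ xᴴ, hVV, Matrix.one_mul]

/-- `D ≤ ρ_θ`: for square matrices `θ(x)` and `θ(y)` are representatives of `[x]` and `[y]`, and
appending zero columns changes neither distance. -/
lemma distD_le_distTheta (hrn : r ≤ n) (x y : Matrix (Fin n) (Fin r) ℂ) :
    distD x y ≤ distTheta x y := by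
  have key : ∀ x y : Matrix (Fin n) (Fin n) ℂ, distD x y ≤ distTheta x y := by
    intro x y
    obtain ⟨V, hV⟩ := exists_theta_eq_mul x
    obtain ⟨W, hW⟩ := exists_theta_eq_mul y
    rw [distTheta, hV, hW, ← distD_mul_unitary_left x y V, ← distD_mul_unitary_right _ y W]
    exact distD_le_hsNorm _ _
  have h := key (padZero n x) (padZero n y)
  rwa [distD_padZero hrn, distTheta, theta_padZero hrn, theta_padZero hrn] at h

lemma trace_mul_re_nonneg {ι : Type*} [Fintype ι] [DecidableEq ι] {P Q : Matrix ι ι ℂ}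
    (hP : 0 ≤ P) (hQ : 0 ≤ Q) : 0 ≤ (P * Q).trace.re := by
  obtain ⟨B, rfl⟩ := CStarAlgebra.nonneg_iff_eq_star_mul_self.mp hP
  have h := ((Matrix.nonneg_iff_posSemidef.mp hQ).mul_mul_conjTranspose_same B).trace_nonneg
  rw [Matrix.star_eq_conjTranspose, Matrix.mul_assoc, Matrix.trace_mul_comm]
  exact (Complex.nonneg_iff.mp h).1

lemma trace_mul_re_le_trace_abs_mul_abs_re {ι : Type*} [Fintype ι] [DecidableEq ι]
    {X Y : Matrix ι ι ℂ} (hX : X.IsHermitian) (hY : Y.IsHermitian) :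
    (X * Y).trace.re ≤ (CFC.abs X * CFC.abs Y).trace.re := by
  have hX' : IsSelfAdjoint X := hX
  have hY' : IsSelfAdjoint Y := hY
  have h1 := trace_mul_re_nonneg (CFC.posPart_nonneg X) (CFC.negPart_nonneg Y)
  have h2 := trace_mul_re_nonneg (CFC.negPart_nonneg X) (CFC.posPart_nonneg Y)
  rw [← CFC.posPart_add_negPart X hX', ← CFC.posPart_add_negPart Y hY']
  nth_rewrite 1 [← CFC.posPart_sub_negPart X hX', ← CFC.posPart_sub_negPart Y hY']
  simp only [Matrix.mul_add, Matrix.add_mul, Matrix.sub_mul, Matrix.mul_sub, Matrix.trace_add,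
    Matrix.trace_sub, Complex.add_re, Complex.sub_re]
  linarith

lemma abs_fromBlocks (x : Matrix (Fin n) (Fin r) ℂ) :
    CFC.abs (Matrix.fromBlocks 0 x xᴴ 0) =
      Matrix.fromBlocks (theta x) 0 0 (theta xᴴ) := by
  have h0 : 0 ≤ x * xᴴ := (Matrix.posSemidef_self_mul_conjTranspose x).nonneg
  have h1 : 0 ≤ xᴴ * xᴴᴴ := (Matrix.posSemidef_self_mul_conjTranspose xᴴ).nonneg
  refine CFC.sqrt_unique ?_ ?_
  · rw [Matrix.star_eq_conjTranspose, Matrix.fromBlocks_conjTranspose, Matrix.fromBlocks_multiply,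
      Matrix.fromBlocks_multiply, theta, theta, CFC.sqrt_mul_sqrt_self _ h0,
      CFC.sqrt_mul_sqrt_self _ h1]
    simp
  · obtain ⟨B, hB⟩ := CStarAlgebra.nonneg_iff_eq_star_mul_self.mp (CFC.sqrt_nonneg (x * xᴴ))
    obtain ⟨C, hC⟩ := CStarAlgebra.nonneg_iff_eq_star_mul_self.mp (CFC.sqrt_nonneg (xᴴ * xᴴᴴ))
    refine CStarAlgebra.nonneg_iff_eq_star_mul_self.mpr ⟨Matrix.fromBlocks B 0 0 C, ?_⟩
    rw [Matrix.star_eq_conjTranspose, Matrix.fromBlocks_conjTranspose, Matrix.fromBlocks_multiply,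
      theta, theta, hB, hC]
    simp [Matrix.star_eq_conjTranspose]

/-- The Araki-Yamagami inequality `‖θ(x) - θ(y)‖ ≤ √2 ‖x - y‖`, from
`tr (X Y) ≤ tr (|X| |Y|)` for the Hermitian dilations `X = [0, x; x*, 0]` and
`Y = [0, y; y*, 0]`. -/
lemma distTheta_sq_le_hsNorm_sq (x y : Matrix (Fin n) (Fin r) ℂ) :
    distTheta x y ^ 2 ≤ 2 * hsNorm (x - y) ^ 2 := by
  have hH : ∀ x : Matrix (Fin n) (Fin r) ℂ, (Matrix.fromBlocks 0 x xᴴ 0).IsHermitian := by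
    intro x
    simp [Matrix.IsHermitian, Matrix.fromBlocks_conjTranspose]
  have ht : ∀ {p q : ℕ} (x : Matrix (Fin p) (Fin q) ℂ), (theta x)ᴴ = theta x := fun x =>
    (Matrix.nonneg_iff_posSemidef.mp (CFC.sqrt_nonneg (x * xᴴ))).isHermitian.eq
  have h := trace_mul_re_le_trace_abs_mul_abs_re (hH x) (hH y)
  rw [abs_fromBlocks, abs_fromBlocks, Matrix.fromBlocks_multiply, Matrix.fromBlocks_multiply,
    Matrix.trace, Matrix.trace, Fintype.sum_sum_type, Fintype.sum_sum_type] at h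
  have e1 : (theta x * theta y).trace.re = rinner (theta x) (theta y) := by rw [rinner, ht]
  have e2 : (theta xᴴ * theta yᴴ).trace.re = rinner (theta xᴴ) (theta yᴴ) := by rw [rinner, ht]
  have e3 : (x * yᴴ).trace.re = rinner x y := by
    rw [rinner_comm, rinner, Matrix.trace_mul_comm]
  have e4 : ∀ x : Matrix (Fin n) (Fin r) ℂ, rinner xᴴ xᴴ = rinner x x := by
    intro x
    rw [rinner, Matrix.conjTranspose_conjTranspose, Matrix.trace_mul_comm, rinner]
  simp only [Matrix.zero_mul, Matrix.mul_zero, zero_add, add_zero] at h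
  replace h : (x * yᴴ).trace.re + (xᴴ * y).trace.re ≤
    (theta x * theta y).trace.re + (theta xᴴ * theta yᴴ).trace.re := h
  have h' : (xᴴ * y).trace.re = rinner x y := rfl
  rw [h', e1, e2, e3] at h
  have h5 := rinner_self_nonneg (theta xᴴ - theta yᴴ)
  have h6 := rinner_comm (theta x) (theta y)
  have h7 := rinner_comm (theta xᴴ) (theta yᴴ)
  have h8 := rinner_comm x y
  rw [distTheta, hsNorm_sq, hsNorm_sq]
  simp only [rinner_sub_left, rinner_sub_right, rinner_theta_self, e4] at h5 ⊢
  linarith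

lemma distTheta_sq_le (x y : Matrix (Fin n) (Fin r) ℂ) :
    distTheta x y ^ 2 ≤ 2 * distD x y ^ 2 := by
  obtain ⟨V, hV⟩ := exists_conjTranspose_mul_posSemidef x y
  have hVV : (V : Matrix (Fin r) (Fin r) ℂ) * (V : Matrix (Fin r) (Fin r) ℂ)ᴴ = 1 := V.2.2
  have h1 : theta (y * (V : Matrix (Fin r) (Fin r) ℂ)) = theta y := by
    rw [theta, Matrix.conjTranspose_mul, Matrix.mul_assoc, ← Matrix.mul_assoc _ _ yᴴ, hVV,
      Matrix.one_mul, theta]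
  rw [← distD_mul_unitary_right x y V, distD_eq_hsNorm hV, distTheta, ← h1]
  exact distTheta_sq_le_hsNorm_sq _ _

lemma distTheta_nonneg (x y : Matrix (Fin n) (Fin r) ℂ) : 0 ≤ distTheta x y := hsNorm_nonneg _

lemma distTheta_le (x y : Matrix (Fin n) (Fin r) ℂ) : distTheta x y ≤ √2 * distD x y := by
  refine le_of_sq_le_sq ?_ (mul_nonneg (Real.sqrt_nonneg _) (distD_nonneg _ _))
  rw [mul_pow, Real.sq_sqrt zero_le_two]
  exact distTheta_sq_le x y

variable (A : Fin m → Matrix (Fin n) (Fin n) ℂ)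

lemma quot_distTheta_le (hrn : r ≤ n) (x y : Matrix (Fin n) (Fin r) ℂ) :
    quot A distTheta x y ≤ quot A distD x y := by
  refine ENNReal.ofReal_le_ofReal ?_
  rcases (distD_nonneg x y).eq_or_lt' with h0 | h0
  · have h1 := distTheta_sq_le x y
    have h2 : distTheta x y = 0 := by
      rw [h0] at h1
      nlinarith [distTheta_nonneg x y]
    rw [h0, h2]
  · have := distD_le_distTheta hrn x y
    gcongr

lemma quot_distD_le (hrn : r ≤ n) (x y : Matrix (Fin n) (Fin r) ℂ) :
    quot A distD x y ≤ 2 * quot A distTheta x y := by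
  have h2 : (2 : ℝ≥0∞) = ENNReal.ofReal 2 := (ENNReal.ofReal_ofNat 2).symm
  rw [h2, quot, quot, ← ENNReal.ofReal_mul zero_le_two]
  refine ENNReal.ofReal_le_ofReal ?_
  rcases (distD_nonneg x y).eq_or_lt' with h0 | h0
  · rw [h0]
    simp only [ne_eq, OfNat.ofNat_ne_zero, not_false_eq_true, zero_pow, div_zero]
    positivity
  · have h1 := distTheta_sq_le x y
    have h2 : 0 < distTheta x y := h0.trans_le (distD_le_distTheta hrn x y)
    rw [← mul_div_assoc, div_le_div_iff₀ (by positivity) (by positivity)]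
    nlinarith [sq_nonneg ‖alpha A x - alpha A y‖]

variable (z : Matrix (Fin n) (Fin r) ℂ)

lemma distTheta_le_of_distD_le {x y : Matrix (Fin n) (Fin r) ℂ} {R : ℝ}
    (h : distD x y ≤ R / √2) : distTheta x y ≤ R := by
  refine (distTheta_le x y).trans ?_
  rw [mul_comm]
  exact (le_div_iff₀ (by positivity)).mp h

lemma A1_le_A1hat (hrn : r ≤ n) : A1 A z ≤ A1hat A z := by
  refine iSup₂_le fun R hR => le_iSup₂_of_le (R / √2) (by positivity) ?_
  refine iInf_mono fun x => iInf_mono' fun h => ⟨distTheta_le_of_distD_le h, ?_⟩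
  exact iInf₂_mono fun _ _ => quot_distTheta_le A hrn x z

lemma A2_le_A2hat (hrn : r ≤ n) : A2 A z ≤ A2hat A z := by
  refine iSup₂_le fun R hR => le_iSup₂_of_le (R / √2) (by positivity) ?_
  refine iInf₂_mono fun x y => iInf_mono' fun h => ⟨distTheta_le_of_distD_le h, ?_⟩
  refine iInf_mono' fun h => ⟨distTheta_le_of_distD_le h, ?_⟩
  exact iInf₂_mono fun _ _ => iInf_mono fun _ => quot_distTheta_le A hrn x y

lemma A1hat_le (hrn : r ≤ n) : A1hat A z ≤ 2 * A1 A z := by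
  refine iSup₂_le fun R hR => le_trans ?_
    (mul_le_mul_right (le_iSup₂ (f := fun R (_ : 0 < R) => ballInf₁ A distTheta z R) R hR) 2)
  rw [← ENNReal.div_le_iff' two_ne_zero ENNReal.ofNat_ne_top]
  refine le_iInf fun x => le_iInf fun h1 => le_iInf fun h2 => le_iInf fun h3 => ?_
  rw [ENNReal.div_le_iff' two_ne_zero ENNReal.ofNat_ne_top]
  refine le_trans ?_ (quot_distD_le A hrn x z)
  exact iInf_le_of_le x (iInf_le_of_le ((distD_le_distTheta hrn _ _).trans h1)
    (iInf₂_le_of_le h2 h3 le_rfl))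

lemma A2hat_le (hrn : r ≤ n) : A2hat A z ≤ 2 * A2 A z := by
  refine iSup₂_le fun R hR => le_trans ?_
    (mul_le_mul_right (le_iSup₂ (f := fun R (_ : 0 < R) => ballInf₂ A distTheta z R) R hR) 2)
  rw [← ENNReal.div_le_iff' two_ne_zero ENNReal.ofNat_ne_top]
  refine le_iInf₂ fun x y => le_iInf₂ fun h1 h2 => le_iInf₂ fun h3 h4 => le_iInf fun h5 => ?_
  rw [ENNReal.div_le_iff' two_ne_zero ENNReal.ofNat_ne_top]
  refine le_trans ?_ (quot_distD_le A hrn x y)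
  exact iInf₂_le_of_le x y (iInf₂_le_of_le ((distD_le_distTheta hrn _ _).trans h1)
    ((distD_le_distTheta hrn _ _).trans h2) (iInf₂_le_of_le h3 h4 (iInf_le_of_le h5 le_rfl)))

end Comparison

/-! ### The quadratic forms of the measurements -/

section Forms

variable {n r m : ℕ}

lemma rinner_mul_nonneg {B : Matrix (Fin n) (Fin n) ℂ} (hB : B.PosSemidef)
    (x : Matrix (Fin n) (Fin r) ℂ) : 0 ≤ rinner x (B * x) := by
  obtain ⟨C, rfl⟩ := CStarAlgebra.nonneg_iff_eq_star_mul_self.mp hB.nonneg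
  rw [Matrix.star_eq_conjTranspose, Matrix.mul_assoc, ← rinner_mul_left]
  exact rinner_self_nonneg _

lemma rinner_mul_eq_zero_iff {B : Matrix (Fin n) (Fin n) ℂ} (hB : B.PosSemidef)
    (x : Matrix (Fin n) (Fin r) ℂ) : rinner x (B * x) = 0 ↔ B * x = 0 := by
  refine ⟨fun h => ?_, fun h => by rw [h]; simp [rinner]⟩
  obtain ⟨C, rfl⟩ := CStarAlgebra.nonneg_iff_eq_star_mul_self.mp hB.nonneg
  rw [Matrix.star_eq_conjTranspose, Matrix.mul_assoc, ← rinner_mul_left, ← hsNorm_sq,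
    sq_eq_zero_iff, hsNorm_eq_zero] at h
  rw [Matrix.mul_assoc, h, Matrix.mul_zero]

lemma rinner_mul_comm {B : Matrix (Fin n) (Fin n) ℂ} (hB : B.IsHermitian)
    (x y : Matrix (Fin n) (Fin r) ℂ) : rinner x (B * y) = rinner y (B * x) := by
  rw [rinner_comm, rinner_mul_left, hB.eq]

lemma rinner_mul_conjTranspose (x : Matrix (Fin n) (Fin r) ℂ) (B : Matrix (Fin n) (Fin n) ℂ) :
    rinner (x * xᴴ) B = rinner x (B * x) := by
  rw [rinner, rinner, Matrix.conjTranspose_mul, Matrix.conjTranspose_conjTranspose,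
    Matrix.mul_assoc, Matrix.trace_mul_comm, Matrix.mul_assoc]

variable (A : Fin m → Matrix (Fin n) (Fin n) ℂ)

lemma alpha_apply (x : Matrix (Fin n) (Fin r) ℂ) (j : Fin m) :
    alpha A x j = √(rinner x (A j * x)) := by
  rw [← rinner_mul_conjTranspose]
  rfl

lemma norm_alpha_sub_sq (x y : Matrix (Fin n) (Fin r) ℂ) :
    ‖alpha A x - alpha A y‖ ^ 2 = ∑ j, (alpha A x j - alpha A y j) ^ 2 := by
  simp [EuclideanSpace.norm_sq_eq]

end Forms

/-! ### Vanishing of the global bounds -/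

section Vanishing

variable {n r m : ℕ}

lemma sq_sqrt_sub_sqrt_le {u v c : ℝ} (hu : c ≤ u) (hv : 0 ≤ v) (hc : 0 < c) :
    (√u - √v) ^ 2 ≤ (u - v) ^ 2 / c := by
  rw [le_div_iff₀ hc]
  have h1 := Real.sq_sqrt (hc.le.trans hu)
  have h2 := Real.sq_sqrt hv
  have h3 : c ≤ (√u + √v) ^ 2 := by
    nlinarith [Real.sqrt_nonneg u, Real.sqrt_nonneg v,
      mul_nonneg (Real.sqrt_nonneg u) (Real.sqrt_nonneg v)]
  calc (√u - √v) ^ 2 * c ≤ (√u - √v) ^ 2 * (√u + √v) ^ 2 := by gcongr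
    _ = (√u ^ 2 - √v ^ 2) ^ 2 := by ring
    _ = (u - v) ^ 2 := by rw [h1, h2]

lemma exists_generic_vector (A : Fin m → Matrix (Fin n) (Fin n) ℂ) :
    ∃ a : Fin n → ℂ, ∀ j, A j *ᵥ a = 0 → A j = 0 := by
  obtain ⟨a, ha⟩ := Submodule.exists_forall_notMem_of_forall_ne_top
    (fun j : {j // A j ≠ 0} => LinearMap.ker (A j.1).mulVecLin) (by
      rintro ⟨j, hj⟩ h
      refine hj ?_
      rw [LinearMap.ker_eq_top] at h
      ext i l
      have h1 := congrArg (fun f => f (Pi.single l 1) i) h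
      simpa using h1)
  refine ⟨a, fun j hj => ?_⟩
  by_contra h
  exact ha ⟨j, h⟩ (by simpa using hj)

lemma exists_orthogonal_vector (hn : 1 < n) (a : Fin n → ℂ) :
    ∃ b : Fin n → ℂ, b ≠ 0 ∧ star a ⬝ᵥ b = 0 := by
  have h : LinearMap.ker (dotProductBilin ℂ ℂ (star a)) ≠ ⊥ :=
    LinearMap.ker_ne_bot_of_finrank_lt (by simpa using hn)
  obtain ⟨b, hb, hb0⟩ := Submodule.exists_mem_ne_zero_of_ne_bot h
  exact ⟨b, hb0, by simpa using hb⟩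

/-- Along the pencil `P + s Q` with `P* Q = 0` and `P Q* = 0`, the measurements depend on `s` only
through `s²`, so that their difference quotients are `O((s + t)²)`; the distance is
`|s - t| ‖Q‖`. -/
lemma quot_pencil_le {A : Fin m → Matrix (Fin n) (Fin n) ℂ} (hA : ∀ j, (A j).PosSemidef)
    {P Q : Matrix (Fin n) (Fin r) ℂ} (hPQ : Pᴴ * Q = 0) (hPQ' : P * Qᴴ = 0) (hQ : Q ≠ 0)
    (hgen : ∀ j, A j * P = 0 → A j = 0) {s t : ℝ} (hs : 0 ≤ s) (ht : 0 ≤ t) (hst : t ≠ s) :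
    distD (P + t • Q) (P + s • Q) = |t - s| * hsNorm Q ∧
    quot A distD (P + t • Q) (P + s • Q) ≤ ENNReal.ofReal ((t + s) ^ 2 *
      ((∑ j, rinner Q (A j * Q) ^ 2 / rinner P (A j * P)) / rinner Q Q)) := by
  have hQP : Qᴴ * P = 0 := by
    have := congrArg Matrix.conjTranspose hPQ
    simpa using this
  have hQP' : Q * Pᴴ = 0 := by
    have := congrArg Matrix.conjTranspose hPQ'
    simpa using this
  have hD : distD (P + t • Q) (P + s • Q) = |t - s| * hsNorm Q := by
    rw [distD_eq_hsNorm, add_sub_add_left_eq_sub, ← sub_smul, hsNorm_smul]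
    have e : (P + t • Q)ᴴ * (P + s • Q) = Pᴴ * P + (t * s) • (Qᴴ * Q) := by
      simp [Matrix.add_mul, Matrix.mul_add, hPQ, hQP, smul_smul, mul_comm]
    rw [e]
    exact (Matrix.posSemidef_conjTranspose_mul_self P).add
      ((Matrix.posSemidef_conjTranspose_mul_self Q).smul (mul_nonneg ht hs))
  refine ⟨hD, ENNReal.ofReal_le_ofReal ?_⟩
  have hα : ∀ (u : ℝ) (j : Fin m), alpha A (P + u • Q) j =
      √(rinner P (A j * P) + u ^ 2 * rinner Q (A j * Q)) := by
    intro u j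
    rw [alpha_apply, ← rinner_mul_conjTranspose, ← rinner_mul_conjTranspose,
      ← rinner_mul_conjTranspose]
    have e : (P + u • Q) * (P + u • Q)ᴴ = P * Pᴴ + (u ^ 2) • (Q * Qᴴ) := by
      simp [Matrix.add_mul, Matrix.mul_add, hPQ', hQP', smul_smul, sq]
    rw [e, rinner_add_left, rinner_smul_left]
  have hQQ : 0 < rinner Q Q := by
    rw [← hsNorm_sq]
    have := hsNorm_eq_zero.not.mpr hQ
    positivity
  have hts : 0 < (t - s) ^ 2 := by
    have := sub_ne_zero.mpr hst
    positivity
  rw [hD, norm_alpha_sub_sq, mul_pow, sq_abs, hsNorm_sq]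
  rw [← mul_div_assoc, div_le_div_iff₀ (by positivity) hQQ]
  have key : ∑ j, (alpha A (P + t • Q) j - alpha A (P + s • Q) j) ^ 2 ≤
      (t - s) ^ 2 * ((t + s) ^ 2 * ∑ j, rinner Q (A j * Q) ^ 2 / rinner P (A j * P)) := by
    rw [Finset.mul_sum, Finset.mul_sum]
    refine Finset.sum_le_sum fun j _ => ?_
    rw [hα, hα]
    have hc := rinner_mul_nonneg (hA j) P
    have hd := rinner_mul_nonneg (hA j) Q
    rcases hc.eq_or_lt' with h0 | h0
    · have h1 := hgen j ((rinner_mul_eq_zero_iff (hA j) P).mp h0)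
      simp [h1, rinner]
    · refine (sq_sqrt_sub_sqrt_le (c := rinner P (A j * P)) ?_ ?_ h0).trans (le_of_eq ?_)
      · nlinarith [sq_nonneg t]
      · nlinarith [mul_nonneg (sq_nonneg s) hd]
      · ring
  nlinarith

variable (A : Fin m → Matrix (Fin n) (Fin n) ℂ)

lemma distTheta_self (z : Matrix (Fin n) (Fin r) ℂ) : distTheta z z = 0 := by
  rw [distTheta, sub_self, hsNorm_eq_zero.mpr rfl]

lemma A2_le_A1 (z : Matrix (Fin n) (Fin r) ℂ) : A2 A z ≤ A1 A z := by
  refine iSup₂_mono fun R hR => iInf_mono fun x => le_iInf fun h1 => le_iInf fun h2 =>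
    le_iInf fun h3 => ?_
  exact iInf₂_le_of_le z h1 (iInf₂_le_of_le ((distTheta_self z).trans_le hR.le) h2
    (iInf₂_le_of_le le_rfl h3 le_rfl))

lemma A0_le_A1 (z : Matrix (Fin n) (Fin r) ℂ) : A0 r A ≤ A1 A z := by
  refine le_iSup₂_of_le 1 one_pos (le_iInf fun x => le_iInf fun h1 => le_iInf fun h2 =>
    le_iInf fun h3 => ?_)
  exact iInf₂_le_of_le x z (iInf_le_of_le h3 le_rfl)

/-- For `r > 1` the bound `A₁(z)` comes arbitrarily close to zero: take `z = [a | s b | 0]` with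
`a ⟂ b`, `a` outside the kernels of the nonzero `A_j`, and `s` small. -/
lemma iInf_A1_eq_zero (hrn : r ≤ n) (hA : ∀ j, (A j).PosSemidef) (hr : 1 < r) :
    (⨅ (z : Matrix (Fin n) (Fin r) ℂ) (_ : z ≠ 0), A1 A z) = 0 := by
  obtain ⟨a, ha⟩ := exists_generic_vector A
  obtain ⟨b, hb, hab⟩ := exists_orthogonal_vector (hr.trans_le hrn) a
  let e₀ : Fin r → ℂ := Pi.single ⟨0, by omega⟩ 1
  let e₁ : Fin r → ℂ := Pi.single ⟨1, hr⟩ 1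
  have h11 : star e₁ = e₁ := by simp [e₁]
  have h01 : e₀ ⬝ᵥ e₁ = 0 := by simp [e₀, e₁]
  have hd1 : e₁ ⬝ᵥ e₁ = 1 := by simp [e₁]
  have hd0 : e₀ ⬝ᵥ e₀ = 1 := by simp [e₀]
  let P : Matrix (Fin n) (Fin r) ℂ := Matrix.vecMulVec a e₀
  let Q : Matrix (Fin n) (Fin r) ℂ := Matrix.vecMulVec b e₁
  let E : Matrix (Fin r) (Fin r) ℂ := Matrix.vecMulVec e₁ e₁
  have hPQ : Pᴴ * Q = 0 := by
    simp [P, Q, Matrix.conjTranspose_vecMulVec, Matrix.vecMulVec_mul_vecMulVec, hab]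
  have hPQ' : P * Qᴴ = 0 := by
    simp [P, Q, Matrix.conjTranspose_vecMulVec, Matrix.vecMulVec_mul_vecMulVec, h11, h01]
  have hPE : P * E = 0 := by
    rw [Matrix.vecMulVec_mul_vecMulVec, h01, zero_smul]
    exact Matrix.ext fun i j => mul_zero _
  have hQE : Q * E = Q := by simp [Q, E, Matrix.vecMulVec_mul_vecMulVec, hd1]
  have hQe : Q *ᵥ e₁ = b := by simp [Q, Matrix.vecMulVec_mulVec, hd1]
  have hQ : Q ≠ 0 := by
    rintro h
    rw [h, Matrix.zero_mulVec] at hQe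
    exact hb hQe.symm
  have hgen : ∀ j, A j * P = 0 → A j = 0 := by
    intro j hj
    refine ha j ?_
    have : (A j * P) *ᵥ e₀ = A j *ᵥ a := by
      rw [← Matrix.mulVec_mulVec, Matrix.vecMulVec_mulVec, hd0]
      simp
    rw [← this, hj, Matrix.zero_mulVec]
  set K := (∑ j, rinner Q (A j * Q) ^ 2 / rinner P (A j * P)) / rinner Q Q with hK
  have hK0 : 0 ≤ K := div_nonneg (Finset.sum_nonneg fun j _ =>
    div_nonneg (sq_nonneg _) (rinner_mul_nonneg (hA j) P)) (rinner_self_nonneg Q)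
  have hQpos : 0 < hsNorm Q := (hsNorm_nonneg Q).lt_of_ne' (hsNorm_eq_zero.not.mpr hQ)
  have hbound : ∀ s : ℝ, 0 < s → A1 A (P + s • Q) ≤ ENNReal.ofReal ((3 * s) ^ 2 * K) := by
    intro s hs
    refine (A1_le_A1hat A _ hrn).trans (iSup₂_le fun R hR => ?_)
    set δ := min s (R / hsNorm Q) with hδ
    have hδ0 : 0 < δ := lt_min hs (by positivity)
    obtain ⟨h1, h2⟩ := quot_pencil_le hA hPQ hPQ' hQ hgen hs.le (add_pos hs hδ0).le
      (by linarith : s + δ ≠ s)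
    have h3 : distD (P + (s + δ) • Q) (P + s • Q) = δ * hsNorm Q := by
      rw [h1, add_sub_cancel_left, abs_of_pos hδ0]
    have h4 : P + (s + δ) • Q = (P + s • Q) * (1 + (δ / s) • E) := by
      rw [Matrix.mul_add, Matrix.mul_one, Matrix.mul_smul, Matrix.add_mul, Matrix.smul_mul, hPE,
        hQE, zero_add, smul_smul, div_mul_cancel₀ _ hs.ne', add_smul, add_assoc]
    refine iInf₂_le_of_le (P + (s + δ) • Q) ?_ (iInf₂_le_of_le ?_ ?_ (h2.trans ?_))
    · rw [h3]
      exact (le_div_iff₀ hQpos).mp (min_le_right _ _)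
    · rw [h4]
      exact Matrix.rank_mul_le_left _ _
    · intro h
      have h5 := h.distD_eq_zero
      rw [h3] at h5
      exact (mul_pos hδ0 hQpos).ne' h5
    · refine ENNReal.ofReal_le_ofReal (mul_le_mul_of_nonneg_right ?_ hK0)
      have : δ ≤ s := min_le_left _ _
      nlinarith
  have hne : ∀ s : ℝ, 0 < s → P + s • Q ≠ 0 := by
    intro s hs h
    have h1 : (P + s • Q) * E = s • Q := by
      rw [Matrix.add_mul, hPE, Matrix.smul_mul, hQE, zero_add]
    rw [h, Matrix.zero_mul] at h1
    exact (smul_ne_zero hs.ne' hQ) h1.symm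
  have hlim : Filter.Tendsto (fun s : ℝ => ENNReal.ofReal ((3 * s) ^ 2 * K)) (𝓝[>] 0) (𝓝 0) := by
    have h1 : Filter.Tendsto (fun s : ℝ => (3 * s) ^ 2 * K) (𝓝 0) (𝓝 ((3 * 0) ^ 2 * K)) :=
      (Continuous.tendsto (by fun_prop) 0)
    have h2 := ENNReal.tendsto_ofReal
      (h1.mono_left (nhdsWithin_le_nhds (s := Set.Ioi (0 : ℝ))))
    simpa using h2
  refine le_antisymm (ge_of_tendsto hlim ?_) zero_le
  filter_upwards [self_mem_nhdsWithin] with s hs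
  exact iInf₂_le_of_le (P + s • Q) (hne s hs) (hbound s hs)

end Vanishing

/-! ### An eigenvalue as a minimum over the complement of a null space -/

section Eigenvalue

variable {E : Type*} [NormedAddCommGroup E] [InnerProductSpace ℝ E]

lemma inner_apply_eq_sum_eigenvalues [FiniteDimensional ℝ E] {T : E →ₗ[ℝ] E}
    (hT : T.IsSymmetric) {N : ℕ} (hN : Module.finrank ℝ E = N) (v : E) :
    inner ℝ v (T v) =
      ∑ i, hT.eigenvalues hN i * inner ℝ (hT.eigenvectorBasis hN i) v ^ 2 := by
  rw [← (hT.eigenvectorBasis hN).sum_inner_mul_inner v (T v)]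
  refine Finset.sum_congr rfl fun i _ => ?_
  rw [← hT, hT.apply_eigenvectorBasis, inner_smul_left, real_inner_comm]
  simp only [RCLike.ofReal_real_eq_id, id_eq, conj_trivial]
  ring

lemma inner_eq_zero_of_mem_span {κ : Type*} {f : κ → E} {u v : E}
    (hv : v ∈ Submodule.span ℝ (Set.range f)) (h : ∀ i, inner ℝ u (f i) = 0) :
    inner ℝ u v = 0 := by
  have : Submodule.span ℝ (Set.range f) ≤ (ℝ ∙ u)ᗮ := by
    rw [Submodule.span_le]
    rintro _ ⟨i, rfl⟩
    exact Submodule.mem_orthogonal_singleton_iff_inner_right.mpr (h i)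
  exact Submodule.mem_orthogonal_singleton_iff_inner_right.mp (this hv)

/-- Let `T` be positive and vanish on a subspace `S` of dimension `d`. Then the `(N - d)`-th largest
eigenvalue is the minimum of the Rayleigh quotient of `T` over `Sᗮ`. If it is positive, the
eigenvectors of the `N - d` largest eigenvalues span `Sᗮ`; the minimum is attained because the span
of the other eigenvectors, together with that of the `(N - d)`-th, meets `Sᗮ`. -/
lemma eigenvalue_isLeast_of_ker [FiniteDimensional ℝ E] {T : E →ₗ[ℝ] E}
    (hT : T.IsSymmetric) {N d : ℕ} (hN : Module.finrank ℝ E = N)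
    (hpos : ∀ v, 0 ≤ inner ℝ v (T v)) (S : Submodule ℝ E)
    (hS : ∀ v ∈ S, T v = 0) (hd : Module.finrank ℝ S = d) (hdN : d < N) :
    0 ≤ hT.eigenvalues hN ⟨N - d - 1, by omega⟩ ∧
    (∀ v ∈ Sᗮ, hT.eigenvalues hN ⟨N - d - 1, by omega⟩ * ‖v‖ ^ 2 ≤ inner ℝ v (T v)) ∧
    ∃ v ∈ Sᗮ, v ≠ 0 ∧
      inner ℝ v (T v) ≤ hT.eigenvalues hN ⟨N - d - 1, by omega⟩ * ‖v‖ ^ 2 := by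
  set b := hT.eigenvectorBasis hN
  set ev := hT.eigenvalues hN
  set i₀ : Fin N := ⟨N - d - 1, by omega⟩ with hi₀
  have hanti : Antitone ev := hT.eigenvalues_antitone hN
  have hev : ∀ i, 0 ≤ ev i := by
    intro i
    have h := hpos (b i)
    rw [hT.apply_eigenvectorBasis, inner_smul_right] at h
    simpa [b] using h
  have hnorm : ∀ v, ‖v‖ ^ 2 = ∑ i, inner ℝ (b i) v ^ 2 := by
    intro v
    rw [← real_inner_self_eq_norm_sq, ← b.sum_inner_mul_inner v v]
    exact Finset.sum_congr rfl fun i _ => by rw [real_inner_comm, sq]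
  have hdS : Module.finrank ℝ Sᗮ = N - d := by
    have := S.finrank_add_finrank_orthogonal
    omega
  refine ⟨hev i₀, fun v hv => ?_, ?_⟩
  · rcases (hev i₀).eq_or_lt' with h0 | h0
    · rw [h0, zero_mul]
      exact hpos v
    let f : Fin (N - d) → E := fun i => b (Fin.castLE (by omega) i)
    have hf : LinearIndependent ℝ f :=
      b.orthonormal.linearIndependent.comp _ (Fin.castLE_injective _)
    have hle : Submodule.span ℝ (Set.range f) ≤ Sᗮ := by
      rw [Submodule.span_le]
      rintro _ ⟨i, rfl⟩
      rw [SetLike.mem_coe, Submodule.mem_orthogonal]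
      intro s hs
      have h1 : inner ℝ s (T (f i)) = 0 := by rw [← hT, hS s hs, inner_zero_left]
      have h2 : ev i₀ ≤ ev (Fin.castLE (by omega) i) := hanti (by
        have := i.2
        simp only [Fin.le_def, hi₀, Fin.val_castLE]
        omega)
      rw [hT.apply_eigenvectorBasis, inner_smul_right] at h1
      exact (mul_eq_zero.mp h1).resolve_left (by simpa using (h0.trans_le h2).ne')
    have heq : Submodule.span ℝ (Set.range f) = Sᗮ := by
      refine Submodule.eq_of_le_of_finrank_eq hle ?_
      rw [finrank_span_eq_card hf, Fintype.card_fin, hdS]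
    rw [← heq] at hv
    rw [inner_apply_eq_sum_eigenvalues hT hN, hnorm, Finset.mul_sum]
    refine Finset.sum_le_sum fun i _ => ?_
    by_cases hi : i ≤ i₀
    · exact mul_le_mul_of_nonneg_right (hanti hi) (sq_nonneg _)
    · have hz : inner ℝ (b i) v = 0 := by
        refine inner_eq_zero_of_mem_span hv fun l => ?_
        refine b.orthonormal.2 fun h => hi ?_
        have := l.2
        simp only [h, Fin.le_def, hi₀, Fin.val_castLE]
        omega
      rw [hz]
      simp
  · let f : Fin (d + 1) → E := fun i => b ⟨N - d - 1 + i, by have := i.2; omega⟩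
    have hf : LinearIndependent ℝ f :=
      b.orthonormal.linearIndependent.comp _ fun i j h => Fin.ext (by
        have := congrArg Fin.val h
        simpa using this)
    have hne : Sᗮ ⊓ Submodule.span ℝ (Set.range f) ≠ ⊥ := by
      intro h
      have h1 := Submodule.finrank_sup_add_finrank_inf_eq Sᗮ (Submodule.span ℝ (Set.range f))
      have h2 := Submodule.finrank_le (Sᗮ ⊔ Submodule.span ℝ (Set.range f))
      rw [h, finrank_bot, finrank_span_eq_card hf, Fintype.card_fin, hdS] at h1
      omega
    obtain ⟨v, hv, hv0⟩ := Submodule.exists_mem_ne_zero_of_ne_bot hne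
    refine ⟨v, hv.1, hv0, ?_⟩
    rw [inner_apply_eq_sum_eigenvalues hT hN, hnorm, Finset.mul_sum]
    refine Finset.sum_le_sum fun i _ => ?_
    by_cases hi : i₀ ≤ i
    · exact mul_le_mul_of_nonneg_right (hanti hi) (sq_nonneg _)
    · have hz : inner ℝ (b i) v = 0 := by
        refine inner_eq_zero_of_mem_span hv.2 fun l => ?_
        refine b.orthonormal.2 fun h => hi ?_
        rw [h, Fin.le_def, hi₀]
        simp
      rw [hz]
      simp

end Eigenvalue

/-! ### Vertical and horizontal directions -/

section Horizontal

variable {n k : ℕ}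

lemma finrank_skewAdjoint_matrix (k : ℕ) :
    Module.finrank ℝ (skewAdjoint (Matrix (Fin k) (Fin k) ℂ)) = k ^ 2 := by
  have e : skewAdjoint (Matrix (Fin k) (Fin k) ℂ) ≃ₗ[ℝ]
      selfAdjoint (Matrix (Fin k) (Fin k) ℂ) := by
    refine LinearEquiv.ofBijective skewAdjoint.negISMul ⟨fun x y h => ?_, fun a => ?_⟩
    · have h1 := congrArg (fun a : selfAdjoint _ => (a : Matrix (Fin k) (Fin k) ℂ)) h
      simp only [skewAdjoint.negISMul_apply_coe] at h1
      exact Subtype.ext (smul_right_injective _ (neg_ne_zero.mpr Complex.I_ne_zero) h1)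
    · refine ⟨⟨Complex.I • (a : Matrix (Fin k) (Fin k) ℂ), ?_⟩, Subtype.ext ?_⟩
      · rw [skewAdjoint.mem_iff, star_smul, a.2.star_eq]
        simp
      · simp [smul_smul]
  have h1 := (StarModule.decomposeProdAdjoint ℝ (Matrix (Fin k) (Fin k) ℂ)).finrank_eq
  have hfin := Module.Finite.equiv (StarModule.decomposeProdAdjoint ℝ (Matrix (Fin k) (Fin k) ℂ))
  have hfs : Module.Finite ℝ (selfAdjoint (Matrix (Fin k) (Fin k) ℂ)) :=
    Module.Finite.of_surjective (LinearMap.fst ℝ _ (skewAdjoint (Matrix (Fin k) (Fin k) ℂ)))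
      LinearMap.fst_surjective
  have hfk : Module.Finite ℝ (skewAdjoint (Matrix (Fin k) (Fin k) ℂ)) := Module.Finite.equiv e.symm
  have h2 : Module.finrank ℝ (Matrix (Fin k) (Fin k) ℂ) = 2 * k ^ 2 := by
    rw [Module.finrank_matrix, Complex.finrank_real_complex, Fintype.card_fin]
    ring
  rw [Module.finrank_prod, h2, ← e.finrank_eq] at h1
  omega

lemma posDef_conjTranspose_mul_self {w : Matrix (Fin n) (Fin k) ℂ} (hw : w.rank = k) :
    (wᴴ * w).PosDef := by
  rw [(Matrix.posSemidef_conjTranspose_mul_self w).posDef_iff_isUnit,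
    ← Matrix.mulVec_injective_iff_isUnit]
  have h := (wᴴ * w).mulVecLin.finrank_range_add_finrank_ker
  have h1 : Module.finrank ℂ (LinearMap.range (wᴴ * w).mulVecLin) = k :=
    (Matrix.rank_conjTranspose_mul_self w).trans hw
  rw [h1, Module.finrank_fin_fun, Nat.add_eq_left, Submodule.finrank_eq_zero] at h
  exact LinearMap.ker_eq_bot.mp h

open scoped Matrix.Norms.L2Operator in
/-- A positive definite matrix stays positive semidefinite under small Hermitian perturbations,
since `c ≤ P` for some `c > 0` and `-‖H‖ ≤ H`. -/
lemma exists_posSemidef_add_smul [NeZero k] {P H : Matrix (Fin k) (Fin k) ℂ} (hP : P.PosDef)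
    (hH : H.IsHermitian) : ∃ δ > 0, ∀ t : ℝ, 0 ≤ t → t ≤ δ → (P + t • H).PosSemidef := by
  have hspec := (StarOrderedRing.isStrictlyPositive_iff_spectrum_pos (R := ℝ) P
    hP.isHermitian.isSelfAdjoint).mp hP.isStrictlyPositive
  obtain ⟨c, hc, hcP⟩ := (CFC.exists_pos_algebraMap_le_iff hP.isHermitian.isSelfAdjoint).mpr hspec
  have hH' := IsSelfAdjoint.neg_algebraMap_norm_le_self (a := H) hH
  refine ⟨c / (‖H‖ + 1), by positivity, fun t ht htδ => ?_⟩
  rw [← Matrix.nonneg_iff_posSemidef]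
  have h1 : t * ‖H‖ ≤ c := by
    have := (le_div_iff₀ (by positivity)).mp htδ
    linarith
  have h2 : 0 ≤ algebraMap ℝ (Matrix (Fin k) (Fin k) ℂ) (c - t * ‖H‖) :=
    algebraMap_nonneg _ (sub_nonneg.mpr h1)
  have h3 : 0 ≤ t • (H - -algebraMap ℝ (Matrix (Fin k) (Fin k) ℂ) ‖H‖) :=
    smul_nonneg ht (sub_nonneg.mpr hH')
  have h4 := add_nonneg (add_nonneg h2 h3) (sub_nonneg.mpr hcP)
  convert h4 using 1
  rw [map_sub, map_mul, Algebra.smul_def, Algebra.smul_def, mul_sub, mul_neg]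
  abel

/-- In `ℂ^{k×k}`, the Hermitian matrices are the real orthogonal complement of the skew-Hermitian
ones. -/
lemma isHermitian_iff_rinner_skew {N : Matrix (Fin k) (Fin k) ℂ} :
    N.IsHermitian ↔ ∀ K ∈ skewAdjoint (Matrix (Fin k) (Fin k) ℂ), rinner K N = 0 := by
  have hstar : ∀ X Y : Matrix (Fin k) (Fin k) ℂ, rinner Xᴴ Yᴴ = rinner X Y := by
    intro X Y
    rw [rinner_comm, rinner, Matrix.conjTranspose_conjTranspose, Matrix.trace_mul_comm, rinner]
  have hneg : ∀ X Y : Matrix (Fin k) (Fin k) ℂ, rinner (-X) Y = -rinner X Y := by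
    intro X Y
    simp [rinner]
  constructor
  · intro hN K hK
    have h1 := hstar K N
    have h2 : Kᴴ = -K := hK
    rw [hN.eq, h2, hneg] at h1
    linarith
  · intro h
    have hK : N - Nᴴ ∈ skewAdjoint (Matrix (Fin k) (Fin k) ℂ) := by
      rw [skewAdjoint.mem_iff, Matrix.star_eq_conjTranspose]
      simp
    have h1 := h _ hK
    have h2 := hstar (N - Nᴴ) N
    have h3 : (N - Nᴴ)ᴴ = -(N - Nᴴ) := hK
    rw [h3, hneg, h1] at h2
    have h4 : rinner (N - Nᴴ) (N - Nᴴ) = 0 := by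
      rw [rinner_sub_right, h1]
      linarith
    rw [← hsNorm_sq, sq_eq_zero_iff, hsNorm_eq_zero, sub_eq_zero] at h4
    exact h4.symm

/-- The vectorisation `μ` as a linear isomorphism onto a Euclidean space. -/
noncomputable def muEquiv (n k : ℕ) :
    Matrix (Fin n) (Fin k) ℂ ≃ₗ[ℝ] EuclideanSpace ℝ (Fin k × (Fin n ⊕ Fin n)) where
  toFun v := WithLp.toLp 2 (mu v)
  invFun u := Matrix.of fun i c => ⟨u (c, Sum.inl i), u (c, Sum.inr i)⟩
  map_add' v v' := by
    ext ⟨c, i | i⟩ <;> simp [mu]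
  map_smul' t v := by
    ext ⟨c, i | i⟩ <;> simp [mu]
  left_inv v := by
    ext i c
    simp [mu]
  right_inv u := by
    ext ⟨c, i | i⟩ <;> simp [mu]

lemma mu_dotProduct (v v' : Matrix (Fin n) (Fin k) ℂ) : mu v ⬝ᵥ mu v' = rinner v v' := by
  rw [rinner_eq_sum, dotProduct, Fintype.sum_prod_type]
  refine Finset.sum_congr rfl fun c _ => ?_
  rw [Fintype.sum_sum_type, Finset.sum_add_distrib]
  rfl

lemma inner_muEquiv (v v' : Matrix (Fin n) (Fin k) ℂ) :
    inner ℝ (muEquiv n k v) (muEquiv n k v') = rinner v v' := by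
  rw [← mu_dotProduct, dotProduct_comm, EuclideanSpace.inner_eq_star_dotProduct]
  rfl

/-- If `M` is positive and kills the vertical directions `w K`, `K* = -K`, of dimension `k²`, its
`(2nk - k²)`-th largest eigenvalue is the minimum of the Rayleigh quotient over the horizontal
directions `v`, those with `w* v` Hermitian. -/
lemma lam_isLeast_horizontal {M : Matrix (Fin k × (Fin n ⊕ Fin n)) (Fin k × (Fin n ⊕ Fin n)) ℝ}
    (hM : M.IsHermitian) (hpos : ∀ v : Matrix (Fin n) (Fin k) ℂ, 0 ≤ mu v ⬝ᵥ M *ᵥ mu v)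
    {w : Matrix (Fin n) (Fin k) ℂ} (hw : w.rank = k) (hk : 0 < k) (hkn : k ≤ n)
    (hker : ∀ K ∈ skewAdjoint (Matrix (Fin k) (Fin k) ℂ), M *ᵥ mu (w * K) = 0) :
    0 ≤ lam hM (2 * n * k - k ^ 2) ∧
    (∀ v, (wᴴ * v).IsHermitian → lam hM (2 * n * k - k ^ 2) * rinner v v ≤ mu v ⬝ᵥ M *ᵥ mu v) ∧
    ∃ v, (wᴴ * v).IsHermitian ∧ v ≠ 0 ∧
      mu v ⬝ᵥ M *ᵥ mu v ≤ lam hM (2 * n * k - k ^ 2) * rinner v v := by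
  let Ψ : skewAdjoint (Matrix (Fin k) (Fin k) ℂ) →ₗ[ℝ] EuclideanSpace ℝ (Fin k × (Fin n ⊕ Fin n)) :=
    { toFun := fun K => muEquiv n k (w * (K : Matrix (Fin k) (Fin k) ℂ))
      map_add' := fun K L => by simp [Matrix.mul_add]
      map_smul' := fun t K => by simp }
  have hΨ : Function.Injective Ψ := by
    rw [← LinearMap.ker_eq_bot, LinearMap.ker_eq_bot']
    intro K hK
    have h1 : w * (K : Matrix (Fin k) (Fin k) ℂ) = 0 :=
      (LinearEquiv.map_eq_zero_iff (muEquiv n k)).mp hK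
    have h2 : (wᴴ * w) * (K : Matrix (Fin k) (Fin k) ℂ) = 0 := by
      rw [Matrix.mul_assoc, h1, Matrix.mul_zero]
    exact Subtype.ext ((posDef_conjTranspose_mul_self hw).isUnit.mul_right_eq_zero.mp h2)
  set S := LinearMap.range Ψ with hS
  have hdS : Module.finrank ℝ S = k ^ 2 := by
    rw [hS, LinearMap.finrank_range_of_inj hΨ, finrank_skewAdjoint_matrix]
  have horth : ∀ v, muEquiv n k v ∈ Sᗮ ↔ (wᴴ * v).IsHermitian := by
    intro v
    rw [Submodule.mem_orthogonal, isHermitian_iff_rinner_skew]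
    constructor
    · intro h K hK
      rw [← rinner_mul_left, ← inner_muEquiv]
      exact h _ ⟨⟨K, hK⟩, rfl⟩
    · rintro h _ ⟨K, rfl⟩
      have := h K K.2
      rwa [← rinner_mul_left, ← inner_muEquiv] at this
  have hT := Matrix.isSymmetric_toEuclideanLin_iff.mpr hM
  have hq : ∀ v, inner ℝ (muEquiv n k v) (Matrix.toEuclideanLin M (muEquiv n k v)) =
      mu v ⬝ᵥ M *ᵥ mu v := by
    intro v
    rw [EuclideanSpace.inner_eq_star_dotProduct, dotProduct_comm]
    rfl
  have hN : Module.finrank ℝ (EuclideanSpace ℝ (Fin k × (Fin n ⊕ Fin n))) =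
    Fintype.card (Fin k × (Fin n ⊕ Fin n)) := finrank_euclideanSpace
  have hcard : Fintype.card (Fin k × (Fin n ⊕ Fin n)) = 2 * n * k := by
    simp
    ring
  have hlt : k ^ 2 < 2 * n * k := by nlinarith
  obtain ⟨h1, h2, v, h3, h4, h5⟩ := eigenvalue_isLeast_of_ker hT hN (fun u => by
      obtain ⟨v, rfl⟩ := (muEquiv n k).surjective u
      rw [hq]
      exact hpos v) S (by
      rintro _ ⟨K, rfl⟩
      exact congrArg (WithLp.toLp 2) (hker K K.2)) hdS (hcard ▸ hlt)
  have hlam : lam hM (2 * n * k - k ^ 2) = hT.eigenvalues hN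
      ⟨Fintype.card (Fin k × (Fin n ⊕ Fin n)) - k ^ 2 - 1, by omega⟩ := by
    rw [lam, dif_pos (by omega), Matrix.IsHermitian.eigenvalues₀]
    congr 2
    omega
  have hnorm : ∀ v, ‖muEquiv n k v‖ ^ 2 = rinner v v := by
    intro v
    rw [← real_inner_self_eq_norm_sq, inner_muEquiv]
  rw [hlam]
  refine ⟨h1, fun v hv => ?_, ?_⟩
  · have := h2 _ ((horth v).mpr hv)
    rwa [hnorm, hq] at this
  · obtain ⟨v, rfl⟩ := (muEquiv n k).surjective v
    rw [hnorm, hq] at h5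
    exact ⟨v, (horth v).mp h3, fun h => h4 (by rw [h, map_zero]), h5⟩

end Horizontal

/-! ### The quadratic forms of `T̂_z` and `R̂_z` -/

section QuadraticForms

variable {n r m k : ℕ}

lemma Fmat_mulVec_mu (B : Matrix (Fin n) (Fin n) ℂ) (v : Matrix (Fin n) (Fin k) ℂ) :
    Fmat k B *ᵥ mu v = mu (B * v) := by
  have h : ∀ (c : Fin k) (s : Fin n ⊕ Fin n),
      (Fmat k B *ᵥ mu v) (c, s) = ∑ t, realify B s t * mu v (c, t) := by
    intro c s
    rw [Matrix.mulVec, dotProduct, Fintype.sum_prod_type, Finset.sum_eq_single c]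
    · simp [Fmat, Matrix.kroneckerMap_apply]
    · intro d _ hd
      simp [Fmat, Matrix.kroneckerMap_apply, hd.symm]
    · simp
  ext ⟨c, i | i⟩
  · rw [h, Fintype.sum_sum_type]
    simp [realify, mu, Matrix.mul_apply, Finset.sum_add_distrib, sub_eq_add_neg]
  · rw [h, Fintype.sum_sum_type]
    simp [realify, mu, Matrix.mul_apply, Finset.sum_add_distrib, add_comm]

variable {A : Fin m → Matrix (Fin n) (Fin n) ℂ}

lemma That_mulVec_mu (z : Matrix (Fin n) (Fin r) ℂ) (w v : Matrix (Fin n) (Fin k) ℂ) :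
    That A z w *ᵥ mu v = ∑ j ∈ (I0 A z)ᶜ,
      (rinner w (A j * v) / rinner w (A j * w)) • mu (A j * w) := by
  rw [That, Matrix.sum_mulVec]
  refine Finset.sum_congr rfl fun j _ => ?_
  rw [Matrix.smul_mulVec, ← Matrix.mulVec_mulVec, ← Matrix.mulVec_mulVec, Fmat_mulVec_mu,
    Matrix.vecMulVec_mulVec, Fmat_mulVec_mu, mu_dotProduct, mu_dotProduct, div_eq_inv_mul,
    ← smul_smul]
  congr 1
  rw [op_smul_eq_smul, Matrix.mulVec_smul, Fmat_mulVec_mu]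

lemma mu_dotProduct_That (hA : ∀ j, (A j).PosSemidef) (z : Matrix (Fin n) (Fin r) ℂ)
    (w v : Matrix (Fin n) (Fin k) ℂ) :
    mu v ⬝ᵥ That A z w *ᵥ mu v =
      ∑ j ∈ (I0 A z)ᶜ, rinner w (A j * v) ^ 2 / rinner w (A j * w) := by
  rw [That_mulVec_mu, dotProduct_sum]
  refine Finset.sum_congr rfl fun j _ => ?_
  rw [dotProduct_smul, mu_dotProduct, rinner_mul_comm (hA j).isHermitian v w, smul_eq_mul]
  ring

lemma Rhat_mulVec_mu (z : Matrix (Fin n) (Fin r) ℂ) (v : Matrix (Fin n) (Fin k) ℂ) :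
    Rhat k A z *ᵥ mu v = ∑ j ∈ I0 A z, mu (A j * v) := by
  rw [Rhat, Matrix.sum_mulVec]
  exact Finset.sum_congr rfl fun j _ => Fmat_mulVec_mu _ _

lemma mu_dotProduct_Rhat (z : Matrix (Fin n) (Fin r) ℂ) (v : Matrix (Fin n) (Fin k) ℂ) :
    mu v ⬝ᵥ Rhat k A z *ᵥ mu v = ∑ j ∈ I0 A z, rinner v (A j * v) := by
  rw [Rhat_mulVec_mu, dotProduct_sum]
  exact Finset.sum_congr rfl fun j _ => mu_dotProduct _ _

lemma alpha_padZero_mul (hk : k ≤ r) (w : Matrix (Fin n) (Fin k) ℂ)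
    (U : Matrix.unitaryGroup (Fin r) ℂ) :
    alpha A (padZero r w * (U : Matrix (Fin r) (Fin r) ℂ)) = alpha A w := by
  have hU : (U : Matrix (Fin r) (Fin r) ℂ) * (U : Matrix (Fin r) (Fin r) ℂ)ᴴ = 1 := U.2.2
  ext j
  rw [alpha_apply, alpha_apply, ← rinner_mul_conjTranspose, ← rinner_mul_conjTranspose,
    Matrix.conjTranspose_mul, Matrix.mul_assoc, ← Matrix.mul_assoc _ _ (padZero r w)ᴴ, hU,
    Matrix.one_mul, padZero_mul_conjTranspose hk]

lemma mem_I0_iff (hA : ∀ j, (A j).PosSemidef) (hk : k ≤ r)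
    (w : Matrix (Fin n) (Fin k) ℂ) (U : Matrix.unitaryGroup (Fin r) ℂ) (j : Fin m) :
    j ∈ I0 A (padZero r w * (U : Matrix (Fin r) (Fin r) ℂ)) ↔ A j * w = 0 := by
  rw [I0, Finset.mem_filter, alpha_padZero_mul hk, alpha_apply,
    Real.sqrt_eq_zero (rinner_mul_nonneg (hA j) w), rinner_mul_eq_zero_iff (hA j)]
  simp

lemma That_mulVec_mu_skew (hA : ∀ j, (A j).PosSemidef) (z : Matrix (Fin n) (Fin r) ℂ)
    (w : Matrix (Fin n) (Fin k) ℂ)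
    {K : Matrix (Fin k) (Fin k) ℂ} (hK : K ∈ skewAdjoint (Matrix (Fin k) (Fin k) ℂ)) :
    That A z w *ᵥ mu (w * K) = 0 := by
  rw [That_mulVec_mu]
  refine Finset.sum_eq_zero fun j _ => ?_
  have hH : (wᴴ * (A j * w)).IsHermitian := by
    rw [Matrix.IsHermitian, Matrix.conjTranspose_mul, Matrix.conjTranspose_mul,
      Matrix.conjTranspose_conjTranspose, (hA j).isHermitian.eq, Matrix.mul_assoc]
  have h := isHermitian_iff_rinner_skew.mp hH K hK
  rw [← rinner_mul_left, rinner_mul_comm (hA j).isHermitian] at h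
  rw [h, zero_div, zero_smul]

end QuadraticForms

/-! ### Difference quotients of the measurements -/

section Differentiation

variable {n k : ℕ}

lemma tendsto_rinner {τ : Type*} {l : Filter τ} {f g : τ → Matrix (Fin n) (Fin k) ℂ}
    {a b : Matrix (Fin n) (Fin k) ℂ} (hf : Filter.Tendsto f l (𝓝 a))
    (hg : Filter.Tendsto g l (𝓝 b)) :
    Filter.Tendsto (fun t => rinner (f t) (g t)) l (𝓝 (rinner a b)) := by
  have hf' : ∀ i j, Filter.Tendsto (fun t => f t i j) l (𝓝 (a i j)) := fun i j =>
    tendsto_pi_nhds.mp (tendsto_pi_nhds.mp hf i) j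
  have hg' : ∀ i j, Filter.Tendsto (fun t => g t i j) l (𝓝 (b i j)) := fun i j =>
    tendsto_pi_nhds.mp (tendsto_pi_nhds.mp hg i) j
  have hre : ∀ c : ℂ, Filter.Tendsto Complex.re (𝓝 c) (𝓝 c.re) := fun c =>
    Complex.continuous_re.tendsto c
  have him : ∀ c : ℂ, Filter.Tendsto Complex.im (𝓝 c) (𝓝 c.im) := fun c =>
    Complex.continuous_im.tendsto c
  simp only [rinner_eq_sum]
  exact tendsto_finsetSum _ fun j _ => tendsto_finsetSum _ fun i _ =>
    (((hre _).comp (hf' i j)).mul ((hre _).comp (hg' i j))).add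
      (((him _).comp (hf' i j)).mul ((him _).comp (hg' i j)))

lemma tendsto_mul_left {τ : Type*} {l : Filter τ} {f : τ → Matrix (Fin n) (Fin k) ℂ}
    {a : Matrix (Fin n) (Fin k) ℂ} (B : Matrix (Fin n) (Fin n) ℂ)
    (hf : Filter.Tendsto f l (𝓝 a)) : Filter.Tendsto (fun t => B * f t) l (𝓝 (B * a)) :=
  by
  have h : Continuous fun x : Matrix (Fin n) (Fin k) ℂ => B * x :=
    continuous_const.matrix_mul continuous_id
  exact (h.tendsto a).comp hf

variable {B : Matrix (Fin n) (Fin n) ℂ} {τ : Type*} {l : Filter τ}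

/-- Strict differentiability of `x ↦ ⟨x, B x⟩^{1/2}` at a point `w` where it does not vanish. -/
lemma tendsto_sq_div_of_pos (hB : B.PosSemidef) {w u₀ : Matrix (Fin n) (Fin k) ℂ}
    (hw : 0 < rinner w (B * w)) {y u : τ → Matrix (Fin n) (Fin k) ℂ} {ε : τ → ℝ}
    (hy : Filter.Tendsto y l (𝓝 w)) (hu : Filter.Tendsto u l (𝓝 u₀))
    (hε : Filter.Tendsto ε l (𝓝 0)) (hε0 : ∀ᶠ t in l, 0 < ε t) :
    Filter.Tendsto (fun t => ((√(rinner (y t + ε t • u t) (B * (y t + ε t • u t))) -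
      √(rinner (y t) (B * y t))) / ε t) ^ 2) l
      (𝓝 (rinner w (B * u₀) ^ 2 / rinner w (B * w))) := by
  have hx : Filter.Tendsto (fun t => y t + ε t • u t) l (𝓝 w) := by
    simpa using hy.add (hε.smul hu)
  have h1 := (tendsto_rinner hx (tendsto_mul_left B hx)).sqrt
  have h2 := (tendsto_rinner hy (tendsto_mul_left B hy)).sqrt
  have h3 := tendsto_rinner (hx.add hy) (tendsto_mul_left B hu)
  have hpos : 0 < √(rinner w (B * w)) := Real.sqrt_pos.mpr hw
  have h4 := (h3.div (h1.add h2) (by positivity)).pow 2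
  have hval : (rinner (w + w) (B * u₀) / (√(rinner w (B * w)) + √(rinner w (B * w)))) ^ 2 =
      rinner w (B * u₀) ^ 2 / rinner w (B * w) := by
    rw [rinner_add_left, div_pow, ← two_mul, ← two_mul, mul_pow, mul_pow,
      Real.sq_sqrt hw.le, mul_div_mul_left _ _ (by norm_num)]
  rw [hval] at h4
  refine h4.congr' ?_
  filter_upwards [hε0, h1.eventually (lt_mem_nhds hpos)] with t ht hxt
  rw [Pi.div_apply]
  generalize hxdef : y t + ε t • u t = x at hxt ⊢
  have hyn := Real.sqrt_nonneg (rinner (y t) (B * y t))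
  have hS : 0 < √(rinner x (B * x)) + √(rinner (y t) (B * y t)) := by linarith
  have e1 := Real.sq_sqrt (rinner_mul_nonneg hB x)
  have e2 := Real.sq_sqrt (rinner_mul_nonneg hB (y t))
  have e3 : rinner x (B * x) - rinner (y t) (B * y t) = ε t * rinner (x + y t) (B * u t) := by
    have h5 : ε t • u t = x - y t := by rw [← hxdef, add_sub_cancel_left]
    rw [← rinner_smul_right, ← Matrix.mul_smul, h5, Matrix.mul_sub, rinner_sub_right,
      rinner_add_left, rinner_add_left, rinner_mul_comm hB.isHermitian (y t) x]
    ring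
  congr 1
  rw [div_eq_div_iff hS.ne' ht.ne']
  nlinarith

lemma div_sq_of_mul_eq_zero {w : Matrix (Fin n) (Fin k) ℂ} (hB : B.PosSemidef)
    (hw : B * w = 0) (u : Matrix (Fin n) (Fin k) ℂ) {ε : ℝ} (hε : ε ≠ 0) :
    ((√(rinner (w + ε • u) (B * (w + ε • u))) - √(rinner w (B * w))) / ε) ^ 2 =
      rinner u (B * u) := by
  have h0 : rinner w (B * w) = 0 := (rinner_mul_eq_zero_iff hB w).mpr hw
  have h1 : rinner (w + ε • u) (B * (w + ε • u)) = ε ^ 2 * rinner u (B * u) := by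
    rw [Matrix.mul_add, hw, zero_add, Matrix.mul_smul, rinner_smul_right, rinner_add_left,
      rinner_mul_comm hB.isHermitian, hw, rinner_smul_left]
    simp [rinner]
    ring
  rw [h0, h1, Real.sqrt_zero, sub_zero, div_pow, Real.sq_sqrt
    (mul_nonneg (sq_nonneg _) (rinner_mul_nonneg hB u))]
  field_simp

lemma isCompact_hsNorm_sphere :
    IsCompact {u : Matrix (Fin n) (Fin k) ℂ | hsNorm u = 1} := by
  let _ := Matrix.frobeniusNormedAddCommGroup (m := Fin n) (n := Fin k) (α := ℂ)
  let _ : NormedSpace ℝ (Matrix (Fin n) (Fin k) ℂ) := Matrix.frobeniusNormedSpace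
  have : ProperSpace (Matrix (Fin n) (Fin k) ℂ) := FiniteDimensional.proper ℝ _
  have h := isCompact_sphere (0 : Matrix (Fin n) (Fin k) ℂ) 1
  have e : {u : Matrix (Fin n) (Fin k) ℂ | hsNorm u = 1} = Metric.sphere 0 1 := by
    ext u
    rw [mem_sphere_zero_iff_norm]
    rfl
  rw [e]
  exact h

lemma tendsto_of_hsNorm_sub {f : τ → Matrix (Fin n) (Fin k) ℂ} {w : Matrix (Fin n) (Fin k) ℂ}
    (h : Filter.Tendsto (fun t => hsNorm (f t - w)) l (𝓝 0)) : Filter.Tendsto f l (𝓝 w) := by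
  let _ := Matrix.frobeniusNormedAddCommGroup (m := Fin n) (n := Fin k) (α := ℂ)
  exact tendsto_iff_norm_sub_tendsto_zero.mpr h

end Differentiation

/-! ### Reduction to full-rank factors -/

section Reduction

variable {n r m k : ℕ}

lemma padZero_padZero {l : ℕ} (hl : l ≤ k) (w : Matrix (Fin n) (Fin l) ℂ) :
    padZero r (padZero k w) = padZero r w := by
  ext i c
  by_cases h : (c : ℕ) < l
  · simp [padZero, h, h.trans_le hl]
  · simp [padZero, h]

/-- A matrix of rank at most `k` has a factor with `k` columns, which can be aligned with a given
`y`. -/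
lemma exists_aligned_factor {x : Matrix (Fin n) (Fin r) ℂ} (hx : x.rank ≤ k) (hk : k ≤ r)
    (y : Matrix (Fin n) (Fin k) ℂ) :
    ∃ (x' : Matrix (Fin n) (Fin k) ℂ) (V : Matrix.unitaryGroup (Fin r) ℂ),
      x = padZero r x' * (V : Matrix (Fin r) (Fin r) ℂ) ∧ (yᴴ * x').PosSemidef := by
  obtain ⟨w, -, U, hU⟩ := exists_isReduced x rfl
  obtain ⟨V, hV⟩ := exists_conjTranspose_mul_posSemidef y (padZero k w)
  obtain ⟨V', hV'⟩ := exists_unitary_padZero (n := n) hk V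
  refine ⟨padZero k w * (V : Matrix (Fin k) (Fin k) ℂ), V'⁻¹ * U, ?_, hV⟩
  have h1 : (V' : Matrix (Fin r) (Fin r) ℂ) * ((V'⁻¹ : Matrix.unitaryGroup (Fin r) ℂ) :
      Matrix (Fin r) (Fin r) ℂ) = 1 := by
    rw [← Submonoid.coe_mul, mul_inv_cancel, OneMemClass.coe_one]
  rw [hV', padZero_padZero hx, Submonoid.coe_mul, ← Matrix.mul_assoc,
    Matrix.mul_assoc (padZero r w), h1, Matrix.mul_one, ← hU]

lemma distD_padZero_mul (hk : k ≤ r) {x y : Matrix (Fin n) (Fin k) ℂ}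
    (h : (yᴴ * x).PosSemidef) (U V : Matrix.unitaryGroup (Fin r) ℂ) :
    distD (padZero r x * (U : Matrix (Fin r) (Fin r) ℂ))
      (padZero r y * (V : Matrix (Fin r) (Fin r) ℂ)) = hsNorm (x - y) := by
  rw [distD_mul_unitary_left, distD_mul_unitary_right, distD_padZero hk,
    distD_eq_hsNorm (conjTranspose_mul_posSemidef_symm h)]

lemma rank_padZero_mul_le (w : Matrix (Fin n) (Fin k) ℂ) (M : Matrix (Fin r) (Fin r) ℂ) :
    (padZero r w * M).rank ≤ k := by
  rw [padZero_eq_mul, Matrix.mul_assoc]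
  exact (Matrix.rank_mul_le_left _ _).trans w.rank_le_width

lemma uEquiv_padZero_mul (w : Matrix (Fin n) (Fin k) ℂ) (U V : Matrix.unitaryGroup (Fin r) ℂ) :
    UEquiv (padZero r w * (U : Matrix (Fin r) (Fin r) ℂ))
      (padZero r w * (V : Matrix (Fin r) (Fin r) ℂ)) := by
  refine ⟨V⁻¹ * U, ?_⟩
  rw [Matrix.mul_assoc, ← Submonoid.coe_mul, mul_inv_cancel_left]

end Reduction

/-! ### The local bounds -/

section Local

variable {n r m k : ℕ} {A : Fin m → Matrix (Fin n) (Fin n) ℂ} {w : Matrix (Fin n) (Fin k) ℂ}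

/-- A strict lower bound for the limits of the difference quotients in horizontal unit directions
holds for all difference quotients near `w`, by compactness of the unit sphere. The set `S`
restricts the second points and `J` the measurements taken into account. -/
lemma exists_ball_le_sum {J : Finset (Fin m)} {S : Set (Matrix (Fin n) (Fin k) ℂ)}
    {q : Matrix (Fin n) (Fin k) ℂ → ℝ} {c : ℝ}
    (hq : ∀ u, (wᴴ * u).IsHermitian → rinner u u = 1 → c < q u)
    (hlim : ∀ (y u : ℕ → Matrix (Fin n) (Fin k) ℂ) (ε : ℕ → ℝ) (u₀ : Matrix (Fin n) (Fin k) ℂ),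
      (∀ i, y i ∈ S) → Filter.Tendsto y Filter.atTop (𝓝 w) →
      Filter.Tendsto u Filter.atTop (𝓝 u₀) → Filter.Tendsto ε Filter.atTop (𝓝 0) →
      (∀ i, 0 < ε i) → Filter.Tendsto
        (fun i => ∑ j ∈ J, ((alpha A (y i + ε i • u i) j - alpha A (y i) j) / ε i) ^ 2)
        Filter.atTop (𝓝 (q u₀))) :
    ∃ δ > 0, ∀ x y, y ∈ S → hsNorm (x - w) ≤ δ → hsNorm (y - w) ≤ δ →
      (yᴴ * x).IsHermitian →
      c * hsNorm (x - y) ^ 2 ≤ ∑ j ∈ J, (alpha A x j - alpha A y j) ^ 2 := by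
  by_contra! hcon
  choose x y hyS hx hy hH hlt using fun i : ℕ => hcon (1 / ((i : ℝ) + 1)) (by positivity)
  have hδ := tendsto_one_div_add_atTop_nhds_zero_nat (𝕜 := ℝ)
  have hyw : Filter.Tendsto y Filter.atTop (𝓝 w) :=
    tendsto_of_hsNorm_sub (squeeze_zero (fun _ => hsNorm_nonneg _) hy hδ)
  have hne : ∀ i, 0 < hsNorm (x i - y i) := by
    intro i
    refine (hsNorm_nonneg _).lt_of_ne' fun h => ?_
    have h1 := hlt i
    rw [h] at h1
    have h2 : 0 ≤ ∑ j ∈ J, (alpha A (x i) j - alpha A (y i) j) ^ 2 :=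
      Finset.sum_nonneg fun j _ => sq_nonneg _
    linarith
  set ε : ℕ → ℝ := fun i => hsNorm (x i - y i) with hεdef
  have hε : Filter.Tendsto ε Filter.atTop (𝓝 0) := by
    refine squeeze_zero (fun _ => hsNorm_nonneg _) (fun i => ?_)
      (by simpa only [add_zero] using hδ.add hδ)
    refine (hsNorm_sub_le (x i) w (y i)).trans (add_le_add (hx i) ?_)
    rw [hsNorm_sub_comm]
    exact hy i
  set u : ℕ → Matrix (Fin n) (Fin k) ℂ := fun i => (ε i)⁻¹ • (x i - y i) with hudef
  have hxe : ∀ i, y i + ε i • u i = x i := by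
    intro i
    rw [hudef, smul_smul, mul_inv_cancel₀ (hne i).ne', one_smul, add_sub_cancel]
  have hu1 : ∀ i, hsNorm (u i) = 1 := by
    intro i
    rw [hudef, hsNorm_smul, abs_of_pos (inv_pos.mpr (hne i))]
    exact inv_mul_cancel₀ (hne i).ne'
  have hfc : FirstCountableTopology (Matrix (Fin n) (Fin k) ℂ) :=
    inferInstanceAs (FirstCountableTopology (Fin n → Fin k → ℂ))
  obtain ⟨u₀, hu₀, φ, hφ, hφu⟩ := isCompact_hsNorm_sphere.tendsto_subseq hu1
  have hlim' := hlim (y ∘ φ) (u ∘ φ) (ε ∘ φ) u₀ (fun i => hyS _) (hyw.comp hφ.tendsto_atTop) hφu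
    (hε.comp hφ.tendsto_atTop) (fun i => hne _)
  have hHu : ∀ i, ((y i)ᴴ * u i).IsHermitian := by
    intro i
    have h := (hH i).sub (Matrix.isHermitian_conjTranspose_mul_self (y i))
    rw [hudef, Matrix.mul_smul, Matrix.mul_sub, Matrix.IsHermitian, Matrix.conjTranspose_smul,
      star_trivial, h.eq]
  have hH0 : (wᴴ * u₀).IsHermitian := by
    rw [isHermitian_iff_rinner_skew]
    intro K hK
    rw [← rinner_mul_left]
    have h1 : Filter.Tendsto (fun i => rinner (y (φ i) * K) (u (φ i))) Filter.atTop
        (𝓝 (rinner (w * K) u₀)) := by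
      refine tendsto_rinner ?_ hφu
      have hc : Continuous fun x : Matrix (Fin n) (Fin k) ℂ => x * K :=
        continuous_id.matrix_mul continuous_const
      exact (hc.tendsto w).comp (hyw.comp hφ.tendsto_atTop)
    have h2 : ∀ i, rinner (y (φ i) * K) (u (φ i)) = 0 := fun i => by
      rw [rinner_mul_left]
      exact isHermitian_iff_rinner_skew.mp (hHu _) K hK
    simp only [h2] at h1
    exact tendsto_nhds_unique h1 tendsto_const_nhds
  have hq0 := hq u₀ hH0 (by rw [← hsNorm_sq, show hsNorm u₀ = 1 from hu₀, one_pow])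
  refine absurd hq0 (not_lt.mpr (le_of_tendsto' hlim' fun i => ?_))
  have h1 := hlt (φ i)
  simp only [Function.comp_apply, hxe, div_pow, ← Finset.sum_div]
  exact (div_le_iff₀ (pow_pos (hne _) 2)).mpr h1.le

lemma ofReal_le_of_forall_lt {a : ℝ} {b : ℝ≥0∞}
    (h : ∀ c < a, ENNReal.ofReal c ≤ b) : ENNReal.ofReal a ≤ b := by
  refine le_of_forall_lt_imp_le_of_dense fun c hc => ?_
  have hct : c ≠ ⊤ := hc.ne_top
  rw [← ENNReal.ofReal_toReal hct] at hc ⊢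
  exact h _ (ENNReal.ofReal_lt_ofReal_iff_of_nonneg ENNReal.toReal_nonneg |>.mp hc)

lemma ofReal_le_quot {x y : Matrix (Fin n) (Fin r) ℂ} {c : ℝ} (hD : 0 < distD x y)
    (h : c * distD x y ^ 2 ≤ ‖alpha A x - alpha A y‖ ^ 2) :
    ENNReal.ofReal c ≤ quot A distD x y :=
  ENNReal.ofReal_le_ofReal ((le_div_iff₀ (pow_pos hD 2)).mpr h)

lemma tendsto_sum_That (hA : ∀ j, (A j).PosSemidef) (hkr : k ≤ r)
    (U : Matrix.unitaryGroup (Fin r) ℂ) {τ : Type*} {l : Filter τ}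
    {y u : τ → Matrix (Fin n) (Fin k) ℂ} {ε : τ → ℝ} {u₀ : Matrix (Fin n) (Fin k) ℂ}
    (hy : Filter.Tendsto y l (𝓝 w)) (hu : Filter.Tendsto u l (𝓝 u₀))
    (hε : Filter.Tendsto ε l (𝓝 0)) (hε0 : ∀ᶠ t in l, 0 < ε t) :
    Filter.Tendsto (fun t => ∑ j ∈ (I0 A (padZero r w * (U : Matrix (Fin r) (Fin r) ℂ)))ᶜ,
        ((alpha A (y t + ε t • u t) j - alpha A (y t) j) / ε t) ^ 2) l
      (𝓝 (mu u₀ ⬝ᵥ That A (padZero r w * (U : Matrix (Fin r) (Fin r) ℂ)) w *ᵥ mu u₀)) := by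
  rw [mu_dotProduct_That hA]
  refine tendsto_finsetSum _ fun j hj => ?_
  rw [Finset.mem_compl, mem_I0_iff hA hkr, ← rinner_mul_eq_zero_iff (hA j)] at hj
  simp only [alpha_apply]
  exact tendsto_sq_div_of_pos (hA j) ((rinner_mul_nonneg (hA j) w).lt_of_ne' hj) hy hu hε hε0

lemma tendsto_sum_That_add_Rhat (hA : ∀ j, (A j).PosSemidef) (hkr : k ≤ r)
    (U : Matrix.unitaryGroup (Fin r) ℂ) {τ : Type*} {l : Filter τ}
    {u : τ → Matrix (Fin n) (Fin k) ℂ} {ε : τ → ℝ} {u₀ : Matrix (Fin n) (Fin k) ℂ}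
    (hu : Filter.Tendsto u l (𝓝 u₀))
    (hε : Filter.Tendsto ε l (𝓝 0)) (hε0 : ∀ᶠ t in l, 0 < ε t) :
    Filter.Tendsto (fun t => ∑ j, ((alpha A (w + ε t • u t) j - alpha A w j) / ε t) ^ 2) l
      (𝓝 (mu u₀ ⬝ᵥ (That A (padZero r w * (U : Matrix (Fin r) (Fin r) ℂ)) w +
        Rhat k A (padZero r w * (U : Matrix (Fin r) (Fin r) ℂ))) *ᵥ mu u₀)) := by
  have h1 := tendsto_sum_That (y := fun _ => w) hA hkr U tendsto_const_nhds hu hε hε0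
  rw [Matrix.add_mulVec, dotProduct_add, mu_dotProduct_Rhat]
  have h2 : Filter.Tendsto (fun t => ∑ j ∈ I0 A (padZero r w * (U : Matrix (Fin r) (Fin r) ℂ)),
      ((alpha A (w + ε t • u t) j - alpha A w j) / ε t) ^ 2) l
      (𝓝 (∑ j ∈ I0 A (padZero r w * (U : Matrix (Fin r) (Fin r) ℂ)),
        rinner u₀ (A j * u₀))) := by
    refine tendsto_finsetSum _ fun j hj => ?_
    rw [mem_I0_iff hA hkr] at hj
    refine (tendsto_rinner hu (tendsto_mul_left (A j) hu)).congr' ?_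
    filter_upwards [hε0] with t ht
    simp only [alpha_apply]
    exact (div_sq_of_mul_eq_zero (hA j) hj (u t) ht.ne').symm
  refine (h1.add h2).congr fun t => ?_
  rw [add_comm, Finset.sum_add_sum_compl]

lemma mu_dotProduct_That_nonneg (hA : ∀ j, (A j).PosSemidef) (z : Matrix (Fin n) (Fin r) ℂ)
    (v : Matrix (Fin n) (Fin k) ℂ) : 0 ≤ mu v ⬝ᵥ That A z w *ᵥ mu v := by
  rw [mu_dotProduct_That hA]
  exact Finset.sum_nonneg fun j _ => div_nonneg (sq_nonneg _) (rinner_mul_nonneg (hA j) w)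

lemma mu_dotProduct_That_add_Rhat_nonneg (hA : ∀ j, (A j).PosSemidef)
    (z : Matrix (Fin n) (Fin r) ℂ) (v : Matrix (Fin n) (Fin k) ℂ) :
    0 ≤ mu v ⬝ᵥ (That A z w + Rhat k A z) *ᵥ mu v := by
  rw [Matrix.add_mulVec, dotProduct_add, mu_dotProduct_Rhat]
  exact add_nonneg (mu_dotProduct_That_nonneg hA z v)
    (Finset.sum_nonneg fun j _ => rinner_mul_nonneg (hA j) v)

/-- `Â₁(z)` for `z = [w | 0] U`. The upper bound comes from the points `w + t v` with `v` a
minimising horizontal direction, which are aligned with `w` for small `t`. -/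
lemma A1hat_padZero (hA : ∀ j, (A j).PosSemidef) (hk : 0 < k) (hkr : k ≤ r) (hkn : k ≤ n)
    (hw : w.rank = k) {z : Matrix (Fin n) (Fin r) ℂ} (hz : z.rank = k)
    {U : Matrix.unitaryGroup (Fin r) ℂ}
    (hU : z = padZero r w * (U : Matrix (Fin r) (Fin r) ℂ)) :
    A1hat A z = ENNReal.ofReal (lam (That_add_Rhat_isHermitian hA z w) (2 * n * k - k ^ 2)) := by
  have : NeZero k := ⟨hk.ne'⟩
  obtain ⟨-, hlow, v, hv, hv0, hvq⟩ := lam_isLeast_horizontal (That_add_Rhat_isHermitian hA z w)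
    (mu_dotProduct_That_add_Rhat_nonneg hA z) hw hk hkn (fun K hK => by
      rw [Matrix.add_mulVec, That_mulVec_mu_skew hA z w hK, Rhat_mulVec_mu, zero_add]
      refine Finset.sum_eq_zero fun j hj => ?_
      rw [hU, mem_I0_iff hA hkr] at hj
      rw [← Matrix.mul_assoc, hj, Matrix.zero_mul]
      exact funext fun ⟨c, s⟩ => by cases s <;> simp [mu])
  set ℓ := lam (That_add_Rhat_isHermitian hA z w) (2 * n * k - k ^ 2)
  have hvpos : 0 < hsNorm v := (hsNorm_nonneg v).lt_of_ne' (hsNorm_eq_zero.not.mpr hv0)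
  refine le_antisymm (iSup₂_le fun R hR => ?_) (ofReal_le_of_forall_lt fun c hc => ?_)
  · obtain ⟨δ, hδ, hps⟩ := exists_posSemidef_add_smul (posDef_conjTranspose_mul_self hw) hv
    have hlim := tendsto_sum_That_add_Rhat (w := w) (u := fun _ : ℝ => v) (ε := fun t => t)
      (l := 𝓝[>] 0) hA hkr U tendsto_const_nhds
      (Filter.tendsto_id.mono_left nhdsWithin_le_nhds) self_mem_nhdsWithin
    rw [← hU] at hlim
    have hlim2 := ENNReal.tendsto_ofReal (hlim.div_const (rinner v v))
    refine le_trans (ge_of_tendsto hlim2 ?_) (ENNReal.ofReal_le_ofReal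
      ((div_le_iff₀ (by rw [← hsNorm_sq]; positivity)).mpr hvq))
    filter_upwards [self_mem_nhdsWithin, Ioc_mem_nhdsGT hδ,
      Ioc_mem_nhdsGT (show 0 < R / hsNorm v by positivity)] with t ht0 ht1 ht2
    have ht : (0 : ℝ) < t := ht0
    have hps' : (wᴴ * (w + t • v)).PosSemidef := by
      rw [Matrix.mul_add, Matrix.mul_smul]
      exact hps t ht.le ht1.2
    have hD := distD_padZero_mul hkr hps' U U
    rw [← hU, add_sub_cancel_left, hsNorm_smul, abs_of_pos ht] at hD
    refine iInf₂_le_of_le (padZero r (w + t • v) * (U : Matrix (Fin r) (Fin r) ℂ)) ?_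
      (iInf₂_le_of_le ?_ ?_ (le_of_eq ?_))
    · rw [hD]
      exact (le_div_iff₀ hvpos).mp ht2.2
    · rw [hz]
      exact rank_padZero_mul_le _ _
    · intro h
      have h5 := h.distD_eq_zero
      rw [hD] at h5
      exact (mul_pos ht hvpos).ne' h5
    · rw [quot, hD, norm_alpha_sub_sq, alpha_padZero_mul hkr, hU, alpha_padZero_mul hkr]
      congr 1
      simp only [div_pow, ← Finset.sum_div]
      rw [div_div, mul_pow, hsNorm_sq]
  · obtain ⟨δ, hδ, hball⟩ := exists_ball_le_sum (A := A) (w := w) (J := Finset.univ) (S := {w})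
      (q := fun u => mu u ⬝ᵥ (That A z w + Rhat k A z) *ᵥ mu u) (c := c) (fun u hu hu1 => by
        have := hlow u hu
        rw [hu1, mul_one] at this
        exact hc.trans_le this) (fun y u ε u₀ hy _ hu hε hε0 => by
        have hy' : ∀ i, y i = w := hy
        have := tendsto_sum_That_add_Rhat (w := w) hA hkr U hu hε (Filter.Eventually.of_forall hε0)
        rw [← hU] at this
        simpa only [hy'] using this)
    refine le_iSup₂_of_le δ hδ (le_iInf fun x => le_iInf fun h1 => le_iInf fun h2 =>
      le_iInf fun h3 => ?_)
    rw [hz] at h2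
    obtain ⟨x', V, rfl, hx'⟩ := exists_aligned_factor h2 hkr w
    have hD := distD_padZero_mul hkr hx' V U
    rw [← hU] at hD
    have hpos : 0 < hsNorm (x' - w) := by
      refine (hsNorm_nonneg _).lt_of_ne' fun h => h3 ?_
      rw [hsNorm_eq_zero, sub_eq_zero] at h
      rw [h, hU]
      exact uEquiv_padZero_mul w V U
    refine ofReal_le_quot (hD ▸ hpos) ?_
    rw [hD, norm_alpha_sub_sq, alpha_padZero_mul hkr, hU, alpha_padZero_mul hkr]
    refine hball x' w rfl (hD ▸ h1) ?_ hx'.isHermitian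
    rw [sub_self, hsNorm_eq_zero.mpr rfl]
    exact hδ.le

/-- `Â₂(z)` for `z = [w | 0] U`. The upper bound comes from the pairs `w + t v`, `w - t v`, on which
the measurements that vanish at `w` agree; hence `R̂_z` does not contribute. -/
lemma A2hat_padZero (hA : ∀ j, (A j).PosSemidef) (hk : 0 < k) (hkr : k ≤ r) (hkn : k ≤ n)
    (hw : w.rank = k) {z : Matrix (Fin n) (Fin r) ℂ} (hz : z.rank = k)
    {U : Matrix.unitaryGroup (Fin r) ℂ}
    (hU : z = padZero r w * (U : Matrix (Fin r) (Fin r) ℂ)) :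
    A2hat A z = ENNReal.ofReal (lam (That_isHermitian hA z w) (2 * n * k - k ^ 2)) := by
  have : NeZero k := ⟨hk.ne'⟩
  obtain ⟨-, hlow, v, hv, hv0, hvq⟩ := lam_isLeast_horizontal (That_isHermitian hA z w)
    (mu_dotProduct_That_nonneg hA z) hw hk hkn (fun K hK => That_mulVec_mu_skew hA z w hK)
  set ℓ := lam (That_isHermitian hA z w) (2 * n * k - k ^ 2)
  have hvpos : 0 < hsNorm v := (hsNorm_nonneg v).lt_of_ne' (hsNorm_eq_zero.not.mpr hv0)
  refine le_antisymm (iSup₂_le fun R hR => ?_) (ofReal_le_of_forall_lt fun c hc => ?_)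
  · have hvw : vᴴ * w = wᴴ * v := by
      have := hv.eq
      rwa [Matrix.conjTranspose_mul, Matrix.conjTranspose_conjTranspose] at this
    obtain ⟨δ, hδ, hps⟩ := exists_posSemidef_add_smul (posDef_conjTranspose_mul_self hw)
      (Matrix.isHermitian_conjTranspose_mul_self v).neg
    have htd : Filter.Tendsto (fun t : ℝ => t) (𝓝[>] 0) (𝓝 0) :=
      Filter.tendsto_id.mono_left nhdsWithin_le_nhds
    have hlim := tendsto_sum_That (u := fun _ : ℝ => v) (ε := fun t => 2 * t)
      (y := fun t => w - t • v) (w := w) (l := 𝓝[>] 0) hA hkr U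
      (by simpa using (tendsto_const_nhds (x := w)).sub (htd.smul (tendsto_const_nhds (x := v))))
      tendsto_const_nhds (by simpa using htd.const_mul 2) (by
        filter_upwards [self_mem_nhdsWithin] with t ht
        exact mul_pos two_pos ht)
    rw [← hU] at hlim
    have hlim2 := ENNReal.tendsto_ofReal (hlim.div_const (rinner v v))
    refine le_trans (ge_of_tendsto hlim2 ?_) (ENNReal.ofReal_le_ofReal
      ((div_le_iff₀ (by rw [← hsNorm_sq]; positivity)).mpr hvq))
    filter_upwards [self_mem_nhdsWithin, Ioc_mem_nhdsGT (Real.sqrt_pos.mpr hδ),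
      Ioc_mem_nhdsGT (show 0 < R / hsNorm v by positivity)] with t ht0 ht1 ht2
    have ht : (0 : ℝ) < t := ht0
    have hxy : w - t • v + (2 * t) • v = w + t • v := by
      rw [two_mul, add_smul]
      abel
    have hsub : w + t • v - (w - t • v) = (2 * t) • v := by rw [← hxy, add_sub_cancel_left]
    have hps' : ((w - t • v)ᴴ * (w + t • v)).PosSemidef := by
      have h1 : (w - t • v)ᴴ * (w + t • v) = wᴴ * w + (t ^ 2) • -(vᴴ * v) := by
        rw [Matrix.conjTranspose_sub, Matrix.conjTranspose_smul, star_trivial, Matrix.sub_mul,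
          Matrix.mul_add, Matrix.mul_add, Matrix.smul_mul, Matrix.smul_mul, Matrix.mul_smul,
          Matrix.mul_smul, hvw, smul_smul, ← sq, smul_neg]
        abel
      rw [h1]
      refine hps _ (sq_nonneg t) ?_
      rw [← Real.sq_sqrt hδ.le]
      exact pow_le_pow_left₀ ht.le ht1.2 2
    have hD := distD_padZero_mul hkr hps' U U
    rw [hsub, hsNorm_smul, abs_of_pos (mul_pos two_pos ht)] at hD
    have hR' : t * hsNorm v ≤ R := (le_div_iff₀ hvpos).mp ht2.2
    have hDz : ∀ x : Matrix (Fin n) (Fin k) ℂ, hsNorm (x - w) = t * hsNorm v →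
        distD (padZero r x * (U : Matrix (Fin r) (Fin r) ℂ)) z ≤ R := by
      intro x hx
      rw [hU, distD_mul_unitary_left, distD_mul_unitary_right, distD_padZero hkr]
      exact (distD_le_hsNorm x w).trans (hx.trans_le hR')
    refine iInf₂_le_of_le (padZero r (w + t • v) * (U : Matrix (Fin r) (Fin r) ℂ))
      (padZero r (w - t • v) * (U : Matrix (Fin r) (Fin r) ℂ)) (iInf₂_le_of_le (hDz _ ?_) (hDz _ ?_)
      (iInf₂_le_of_le ?_ ?_ (iInf_le_of_le ?_ (le_of_eq ?_))))
    · rw [add_sub_cancel_left, hsNorm_smul, abs_of_pos ht]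
    · rw [hsNorm_sub_comm, sub_sub_cancel, hsNorm_smul, abs_of_pos ht]
    · rw [hz]
      exact rank_padZero_mul_le _ _
    · rw [hz]
      exact rank_padZero_mul_le _ _
    · intro h
      have h5 := h.distD_eq_zero
      rw [hD] at h5
      exact (mul_pos (mul_pos two_pos ht) hvpos).ne' h5
    · rw [quot, hD, norm_alpha_sub_sq, alpha_padZero_mul hkr, alpha_padZero_mul hkr, hxy]
      -- the measurements in `I₀(z)` are `⟨t v, A_j (t v)⟩^{1/2}` at both points
      have hI : ∀ j ∈ I0 A z, (alpha A (w + t • v) j - alpha A (w - t • v) j) ^ 2 = 0 := by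
        intro j hj
        rw [hU, mem_I0_iff hA hkr] at hj
        have h0 : ∀ s : ℝ, rinner (w + s • v) (A j * (w + s • v)) =
            s ^ 2 * rinner v (A j * v) := by
          intro s
          rw [Matrix.mul_add, hj, zero_add, Matrix.mul_smul, rinner_smul_right, rinner_add_left,
            rinner_mul_comm (hA j).isHermitian, hj, rinner_smul_left]
          simp [rinner]
          ring
        have h1 := h0 (-t)
        rw [neg_smul, ← sub_eq_add_neg, neg_sq] at h1
        rw [alpha_apply, alpha_apply, h0, h1, sub_self, zero_pow two_ne_zero]
      rw [← Finset.sum_add_sum_compl (I0 A z), Finset.sum_eq_zero hI, zero_add]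
      congr 1
      simp only [div_pow, ← Finset.sum_div]
      rw [div_div, mul_pow _ (hsNorm v), hsNorm_sq]
  · obtain ⟨δ, hδ, hball⟩ := exists_ball_le_sum (A := A) (w := w) (J := (I0 A z)ᶜ) (S := Set.univ)
      (q := fun u => mu u ⬝ᵥ That A z w *ᵥ mu u) (c := c) (fun u hu hu1 => by
        have := hlow u hu
        rw [hu1, mul_one] at this
        exact hc.trans_le this) (fun y u ε u₀ _ hy hu hε hε0 => by
        have := tendsto_sum_That hA hkr U hy hu hε (Filter.Eventually.of_forall hε0)
        rwa [← hU] at this)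
    -- representatives of points at distance `R` from `z` lie within `3 R` of `w`
    refine le_iSup₂_of_le (δ / 3) (by positivity) (le_iInf₂ fun x y => le_iInf₂ fun h1 h2 =>
      le_iInf₂ fun h3 h4 => le_iInf fun h5 => ?_)
    rw [hz] at h3 h4
    obtain ⟨y', W, rfl, hy'⟩ := exists_aligned_factor h4 hkr w
    obtain ⟨x₁, V₁, hx₁, hx₁'⟩ := exists_aligned_factor h3 hkr w
    obtain ⟨x', V, rfl, hx'⟩ := exists_aligned_factor h3 hkr y'
    have hDy := distD_padZero_mul hkr hy' W U
    rw [← hU] at hDy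
    have hDx := distD_padZero_mul hkr hx₁' V₁ U
    rw [← hU, ← hx₁] at hDx
    have hD := distD_padZero_mul hkr hx' V W
    have hyw : hsNorm (y' - w) ≤ δ / 3 := hDy ▸ h2
    have hxw : hsNorm (x₁ - w) ≤ δ / 3 := hDx ▸ h1
    have hxy : hsNorm (x' - y') ≤ hsNorm (x₁ - y') := by
      rw [← hD, hx₁, distD_mul_unitary_left, distD_mul_unitary_right, distD_padZero hkr]
      exact distD_le_hsNorm _ _
    have ht1 := hsNorm_sub_le x₁ w y'
    have ht2 := hsNorm_sub_le x' y' w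
    have ht3 := hsNorm_sub_comm w y'
    have hpos : 0 < hsNorm (x' - y') := by
      refine (hsNorm_nonneg _).lt_of_ne' fun h => h5 ?_
      rw [hsNorm_eq_zero, sub_eq_zero] at h
      rw [h]
      exact uEquiv_padZero_mul y' V W
    refine ofReal_le_quot (hD ▸ hpos) ?_
    rw [hD, norm_alpha_sub_sq, alpha_padZero_mul hkr, alpha_padZero_mul hkr]
    refine (hball x' y' (Set.mem_univ _) (by linarith) (by linarith) hx'.isHermitian).trans ?_
    exact Finset.sum_le_sum_of_subset_of_nonneg (Finset.subset_univ _) fun j _ _ => sq_nonneg _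

end Local

end PhaseRetrieval

theorem theorem4p2 {n r m : ℕ} (hrn : r ≤ n) (A : Fin m → Matrix (Fin n) (Fin n) ℂ)
    (hA : ∀ j, (A j).PosSemidef) :
    (1 < r →
      (⨅ (z : Matrix (Fin n) (Fin r) ℂ) (_ : z ≠ 0), PhaseRetrieval.A1 A z) = 0 ∧
      (⨅ (z : Matrix (Fin n) (Fin r) ℂ) (_ : z ≠ 0), PhaseRetrieval.A2 A z) = 0 ∧
      PhaseRetrieval.A0 r A = 0) ∧
    ∀ (k : ℕ) (z : Matrix (Fin n) (Fin r) ℂ), 0 < k → z.rank = k →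
      (∀ w : Matrix (Fin n) (Fin k) ℂ, PhaseRetrieval.IsReduced z w →
        PhaseRetrieval.A1hat A z = ENNReal.ofReal
          (PhaseRetrieval.lam (PhaseRetrieval.That_add_Rhat_isHermitian hA z w)
            (2 * n * k - k ^ 2)) ∧
        PhaseRetrieval.A2hat A z = ENNReal.ofReal
          (PhaseRetrieval.lam (PhaseRetrieval.That_isHermitian hA z w) (2 * n * k - k ^ 2))) ∧
      (PhaseRetrieval.A1 A z ≤ PhaseRetrieval.A1hat A z ∧
        PhaseRetrieval.A1hat A z ≤ 2 * PhaseRetrieval.A1 A z) ∧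
      (PhaseRetrieval.A2 A z ≤ PhaseRetrieval.A2hat A z ∧
        PhaseRetrieval.A2hat A z ≤ 2 * PhaseRetrieval.A2 A z) := by
  refine ⟨fun hr => ?_, fun k z hk hz => ⟨fun w hw => ?_, ?_, ?_⟩⟩
  · have h1 := PhaseRetrieval.iInf_A1_eq_zero A hrn hA hr
    refine ⟨h1, le_antisymm ?_ zero_le, le_antisymm ?_ zero_le⟩
    · exact (iInf₂_mono fun z _ => PhaseRetrieval.A2_le_A1 A z).trans_eq h1
    · exact (le_iInf₂ fun z _ => PhaseRetrieval.A0_le_A1 A z).trans_eq h1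
  · obtain ⟨hw, U, hU⟩ := hw
    have hkr : k ≤ r := hz ▸ z.rank_le_width
    exact ⟨PhaseRetrieval.A1hat_padZero hA hk hkr (hkr.trans hrn) hw hz hU,
      PhaseRetrieval.A2hat_padZero hA hk hkr (hkr.trans hrn) hw hz hU⟩
  · exact ⟨PhaseRetrieval.A1_le_A1hat A z hrn, PhaseRetrieval.A1hat_le A z hrn⟩
  · exact ⟨PhaseRetrieval.A2_le_A2hat A z hrn, PhaseRetrieval.A2hat_le A z hrn⟩
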